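/- **Conventions.** Let $(X_0,X_1)$ be a compatible couple of (real or complex) Banach spaces, i.e. both are continuously embedded in a Hausdorff topological vector space. For $f\in X_0+X_1$ and $t>0$ let $K(f,t)=\inf\{\|f_0\|_{X_0}+t\|f_1\|_{X_1}: f=f_0+f_1,\ f_i\in X_i\}$; for $f\in X_0\cap X_1$ let $J(f,t)=\max\{\|f\|_{X_0},t\|f\|_{X_1}\}$. The norm of $X_0+X_1$ is $K(\cdot,1)$ and the norm of $X_0\cap X_1$ is $J(\cdot,1)$. For a weight $v:(0,\infty)\to[0,\infty]$, * $(X_0,X_1)_{0,\infty,v;K}$ is the set of all $f\in X_0+X_1$ with $\|f\|_{0,\infty,v;K}:=\operatorname{ess\,sup}_{t>0}v(t)K(f,t)<\infty$; * $(X_0,X_1)_{0,\infty,v;J}$ is the set of all $f\in X_0+X_1$ with $\|f\|_{0,\infty,v;J}:=\inf_u\operatorname{ess\,sup}_{t>0}v(t)J(u(t),t)<\infty$, where the infimum is over all strongly measurable $u:(0,\infty)\to X_0\cap X_1$ with $f=\int_0^\infty u(s)\,\frac{ds}{s}$ (convergence in $X_0+X_1$, as a Bochner integral). Here $\infty\cdot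 0=0$. For a space $Y\subseteq X_0+X_1$, the norm of $X_0+Y$ is $\inf\{\|f_0\|_{X_0}+\|g\|_Y: f=f_0+g,\ f_0\in X_0,\ g\in Y\}$. An equality of spaces means equality as sets with equivalence of the norms. A positive finite Lebesgue measurable function $b$ on $(0,\infty)$ is slowly varying, $b\in SV(0,\infty)$, if for every $\varepsilon>0$ the function $t^{\varepsilon}b(t)$ is equivalent to a non-decreasing function and $t^{-\varepsilon}b(t)$ is equivalent to a non-increasing function on $(0,\infty)$ (two functions are equivalent if each is bounded by a positive constant times the other). $AC(0,\infty)$ is the set of functions that are absolutely continuous on every compact subinterval of $(0,\infty)$. For monotone $g$ on $(0,\infty)$ put $g(0)=\lim_{t\to0+}g(t)$ and $g(\infty)=\lim_{t\to\infty}g(t)$. **Corollary 1.17.** Let $b\in SV(0,\infty)\cap AC(0,\infty)$ be strictly decreasing with $b(0)<\infty$ and $b(\infty)=0$. Let $\beta\in SV(0,\infty)\cap AC(0,\infty)$ be strictly decreasing with $\beta(0)=\infty$ and $\beta(\infty)=0$. Let the function $B\in SV(0,\infty)$ be given by $$B(x)=b(x)\ \text{ if } x\in[1,\infty),\qquad B(x)=c\,\beta(x)\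 \text{ if } x\in(0,1),$$ where the constant $c>0$ is such that $B\in AC(0,\infty)$, and let $$A(x)=\frac{B^2(x)}{x\,(-B'(x))}\quad\text{for a.a. } x>0,$$ where $A(x)=\infty$ if $B'(x)=0$. Then $$(X_0,X_1)_{0,\infty,b;K}=X_0+(X_0,X_1)_{0,\infty,B;K}=X_0+(X_0,X_1)_{0,\infty,A;J}.$$ -/

import Mathlib

open Set Filter Topology MeasureTheory
open scoped ENNReal

/-- A compatible couple: two normed spaces `X₀`, `X₁` continuously (and linearly, injectively)
embedded in a topological vector space `𝒳`. (Completeness of `X₀`, `X₁` and the Hausdorff property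
of `𝒳` are stated as instance arguments where they are used.) -/
structure CompatibleCouple (𝕜 X₀ X₁ 𝒳 : Type*) [RCLike 𝕜]
    [NormedAddCommGroup X₀] [NormedSpace 𝕜 X₀] [NormedAddCommGroup X₁] [NormedSpace 𝕜 X₁]
    [AddCommGroup 𝒳] [Module 𝕜 𝒳] [TopologicalSpace 𝒳] where
  ι₀ : X₀ →L[𝕜] 𝒳
  ι₁ : X₁ →L[𝕜] 𝒳
  injective₀ : Function.Injective ι₀
  injective₁ : Function.Injective ι₁

namespace CompatibleCouple

section Basic

variable {𝕜 X₀ X₁ 𝒳 : Type*} [RCLike 𝕜]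
  [NormedAddCommGroup X₀] [NormedSpace 𝕜 X₀] [NormedAddCommGroup X₁] [NormedSpace 𝕜 X₁]
  [AddCommGroup 𝒳] [Module 𝕜 𝒳] [TopologicalSpace 𝒳]

/-- The vector space `X₀ + X₁ ⊆ 𝒳`. It is a type synonym of the subspace of `𝒳`, because it
carries its own norm (below) and not the topology induced from `𝒳`. -/
def SumSpace (X : CompatibleCouple 𝕜 X₀ X₁ 𝒳) : Type _ :=
  ↥((X.ι₀ : X₀ →ₗ[𝕜] 𝒳).range ⊔ (X.ι₁ : X₁ →ₗ[𝕜] 𝒳).range)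

noncomputable instance (X : CompatibleCouple 𝕜 X₀ X₁ 𝒳) : AddCommGroup X.SumSpace :=
  inferInstanceAs
    (AddCommGroup ↥((X.ι₀ : X₀ →ₗ[𝕜] 𝒳).range ⊔ (X.ι₁ : X₁ →ₗ[𝕜] 𝒳).range))

noncomputable instance (X : CompatibleCouple 𝕜 X₀ X₁ 𝒳) : Module 𝕜 X.SumSpace :=
  inferInstanceAs
    (Module 𝕜 ↥((X.ι₀ : X₀ →ₗ[𝕜] 𝒳).range ⊔ (X.ι₁ : X₁ →ₗ[𝕜] 𝒳).range))

/-- The inclusion `X₀ + X₁ ⊆ 𝒳`. -/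
noncomputable def toAmbient (X : CompatibleCouple 𝕜 X₀ X₁ 𝒳) : X.SumSpace →ₗ[𝕜] 𝒳 :=
  ((X.ι₀ : X₀ →ₗ[𝕜] 𝒳).range ⊔ (X.ι₁ : X₁ →ₗ[𝕜] 𝒳).range).subtype

/-- The inclusion `X₀ ⊆ X₀ + X₁`. -/
noncomputable def incl₀ (X : CompatibleCouple 𝕜 X₀ X₁ 𝒳) : X₀ →ₗ[𝕜] X.SumSpace :=
  LinearMap.codRestrict ((X.ι₀ : X₀ →ₗ[𝕜] 𝒳).range ⊔ (X.ι₁ : X₁ →ₗ[𝕜] 𝒳).range)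
    (X.ι₀ : X₀ →ₗ[𝕜] 𝒳) (fun x => Submodule.mem_sup_left ⟨x, rfl⟩)

/-- The inclusion `X₁ ⊆ X₀ + X₁`. -/
noncomputable def incl₁ (X : CompatibleCouple 𝕜 X₀ X₁ 𝒳) : X₁ →ₗ[𝕜] X.SumSpace :=
  LinearMap.codRestrict ((X.ι₀ : X₀ →ₗ[𝕜] 𝒳).range ⊔ (X.ι₁ : X₁ →ₗ[𝕜] 𝒳).range)
    (X.ι₁ : X₁ →ₗ[𝕜] 𝒳) (fun x => Submodule.mem_sup_right ⟨x, rfl⟩)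

/-- The space `X₀ ∩ X₁`: pairs `(x₀, x₁)` that are the same element of `𝒳`. The norm inherited from
`X₀ × X₁` is the usual one, `max {‖x‖_{X₀}, ‖x‖_{X₁}}`. -/
def interSpace (X : CompatibleCouple 𝕜 X₀ X₁ 𝒳) : Submodule 𝕜 (X₀ × X₁) :=
  LinearMap.eqLocus ((X.ι₀ : X₀ →ₗ[𝕜] 𝒳) ∘ₗ LinearMap.fst 𝕜 X₀ X₁)
    ((X.ι₁ : X₁ →ₗ[𝕜] 𝒳) ∘ₗ LinearMap.snd 𝕜 X₀ X₁)

/-- The inclusion `X₀ ∩ X₁ ⊆ X₀ + X₁`. -/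
noncomputable def interToSum (X : CompatibleCouple 𝕜 X₀ X₁ 𝒳) : X.interSpace →ₗ[𝕜] X.SumSpace :=
  X.incl₀ ∘ₗ LinearMap.fst 𝕜 X₀ X₁ ∘ₗ X.interSpace.subtype

/-- The Peetre `K`-functional `K(f, t; X₀, X₁)`, for `t > 0`: the infimum of
`‖f₀‖_{X₀} + t ‖f₁‖_{X₁}` over all decompositions `f = f₀ + f₁`. -/
noncomputable def K (X : CompatibleCouple 𝕜 X₀ X₁ 𝒳) (f : X.SumSpace) (t : ℝ) : ℝ :=
  sInf {r : ℝ | ∃ (f₀ : X₀) (f₁ : X₁), f = X.incl₀ f₀ + X.incl₁ f₁ ∧ r = ‖f₀‖ + t * ‖f₁‖}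

/-- The Peetre `J`-functional `J(f, t; X₀, X₁) = max {‖f‖_{X₀}, t ‖f‖_{X₁}}`. -/
noncomputable def J (X : CompatibleCouple 𝕜 X₀ X₁ 𝒳) (f : X.interSpace) (t : ℝ) : ℝ :=
  max ‖(f : X₀ × X₁).1‖ (t * ‖(f : X₀ × X₁).2‖)

/-- The norm of `X₀ + X₁`: the infimum of `‖f₀‖_{X₀} + ‖f₁‖_{X₁}` over all `f = f₀ + f₁`. -/
noncomputable instance (X : CompatibleCouple 𝕜 X₀ X₁ 𝒳) : Norm X.SumSpace := ⟨fun f => X.K f 1⟩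

theorem exists_decomp (X : CompatibleCouple 𝕜 X₀ X₁ 𝒳) (f : X.SumSpace) :
    ∃ (f₀ : X₀) (f₁ : X₁), f = X.incl₀ f₀ + X.incl₁ f₁ := by
  obtain ⟨y, ⟨x₀, hx₀⟩, z, ⟨x₁, hx₁⟩, h⟩ := Submodule.mem_sup.1 f.2
  refine ⟨x₀, x₁, Subtype.ext ?_⟩
  rw [← hx₀, ← hx₁] at h
  exact h.symm

theorem norm_le_of_eq (X : CompatibleCouple 𝕜 X₀ X₁ 𝒳) {f : X.SumSpace} {f₀ : X₀} {f₁ : X₁}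
    (h : f = X.incl₀ f₀ + X.incl₁ f₁) : ‖f‖ ≤ ‖f₀‖ + ‖f₁‖ := by
  refine csInf_le ⟨0, ?_⟩ ⟨f₀, f₁, h, by rw [one_mul]⟩
  rintro r ⟨g₀, g₁, -, rfl⟩
  positivity

theorem norm_nonneg' (X : CompatibleCouple 𝕜 X₀ X₁ 𝒳) (f : X.SumSpace) : 0 ≤ ‖f‖ := by
  refine Real.sInf_nonneg ?_
  rintro r ⟨g₀, g₁, -, rfl⟩
  positivity

theorem exists_decomp_lt (X : CompatibleCouple 𝕜 X₀ X₁ 𝒳) (f : X.SumSpace) {ε : ℝ} (hε : 0 < ε) :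
    ∃ (f₀ : X₀) (f₁ : X₁), f = X.incl₀ f₀ + X.incl₁ f₁ ∧ ‖f₀‖ + ‖f₁‖ < ‖f‖ + ε := by
  have hne : {r : ℝ | ∃ (f₀ : X₀) (f₁ : X₁), f = X.incl₀ f₀ + X.incl₁ f₁ ∧
      r = ‖f₀‖ + 1 * ‖f₁‖}.Nonempty := by
    obtain ⟨f₀, f₁, h⟩ := X.exists_decomp f
    exact ⟨_, f₀, f₁, h, rfl⟩
  obtain ⟨r, ⟨f₀, f₁, h, rfl⟩, hr⟩ := exists_lt_of_csInf_lt hne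
    (show X.K f 1 < X.K f 1 + ε by linarith)
  refine ⟨f₀, f₁, h, ?_⟩
  rw [one_mul] at hr
  exact hr

theorem norm_smul_le' (X : CompatibleCouple 𝕜 X₀ X₁ 𝒳) (a : 𝕜) (f : X.SumSpace) :
    ‖a • f‖ ≤ ‖a‖ * ‖f‖ := by
  refine le_of_forall_pos_le_add fun ε hε => ?_
  obtain ⟨f₀, f₁, h, hlt⟩ := X.exists_decomp_lt f (show 0 < ε / (‖a‖ + 1) by positivity)
  have h1 : ‖a • f‖ ≤ ‖a • f₀‖ + ‖a • f₁‖ :=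
    X.norm_le_of_eq (by rw [h, smul_add, map_smul, map_smul])
  rw [norm_smul a f₀, norm_smul a f₁, ← mul_add] at h1
  have h2 : ‖a‖ * (‖f₀‖ + ‖f₁‖) ≤ ‖a‖ * (‖f‖ + ε / (‖a‖ + 1)) :=
    mul_le_mul_of_nonneg_left hlt.le (norm_nonneg a)
  have h3 : ‖a‖ * (ε / (‖a‖ + 1)) ≤ ε := by
    rw [mul_div_assoc', div_le_iff₀ (by positivity)]
    nlinarith [norm_nonneg a]
  linarith

theorem sumSpace_core [IsTopologicalAddGroup 𝒳] [ContinuousSMul 𝕜 𝒳] [T2Space 𝒳]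
    (X : CompatibleCouple 𝕜 X₀ X₁ 𝒳) : NormedSpace.Core 𝕜 X.SumSpace where
  norm_nonneg := X.norm_nonneg'
  norm_smul a f := by
    refine le_antisymm (X.norm_smul_le' a f) ?_
    by_cases ha : a = 0
    · subst ha
      rw [norm_zero, zero_mul]
      exact X.norm_nonneg' _
    · have h := X.norm_smul_le' a⁻¹ (a • f)
      rw [smul_smul, inv_mul_cancel₀ ha, one_smul, norm_inv] at h
      have ha' : 0 < ‖a‖ := norm_pos_iff.2 ha
      calc ‖a‖ * ‖f‖ ≤ ‖a‖ * (‖a‖⁻¹ * ‖a • f‖) := mul_le_mul_of_nonneg_left h ha'.le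
        _ = ‖a • f‖ := by rw [← mul_assoc, mul_inv_cancel₀ ha'.ne', one_mul]
  norm_triangle f g := by
    refine le_of_forall_pos_le_add fun ε hε => ?_
    obtain ⟨f₀, f₁, h, hlt⟩ := X.exists_decomp_lt f (half_pos hε)
    obtain ⟨g₀, g₁, h', hlt'⟩ := X.exists_decomp_lt g (half_pos hε)
    have h1 : ‖f + g‖ ≤ ‖f₀ + g₀‖ + ‖f₁ + g₁‖ :=
      X.norm_le_of_eq (by rw [h, h', map_add, map_add]; abel)
    linarith [norm_add_le f₀ g₀, norm_add_le f₁ g₁]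
  norm_eq_zero_iff f := by
    constructor
    · intro hf
      choose u v huv hlt using fun n : ℕ =>
        X.exists_decomp_lt f (show (0 : ℝ) < 1 / ((n : ℝ) + 1) by positivity)
      have hlim : Tendsto (fun n : ℕ => 1 / ((n : ℝ) + 1)) atTop (𝓝 0) :=
        tendsto_one_div_add_atTop_nhds_zero_nat
      have hu : Tendsto u atTop (𝓝 0) :=
        squeeze_zero_norm (fun n => by linarith [hlt n, norm_nonneg (v n)]) hlim
      have hv : Tendsto v atTop (𝓝 0) :=
        squeeze_zero_norm (fun n => by linarith [hlt n, norm_nonneg (u n)]) hlim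
      have h0 : Tendsto (fun n => X.ι₀ (u n) + X.ι₁ (v n)) atTop (𝓝 0) := by
        have := ((X.ι₀.continuous.tendsto 0).comp hu).add ((X.ι₁.continuous.tendsto 0).comp hv)
        simpa using this
      have hc : (fun n => X.ι₀ (u n) + X.ι₁ (v n)) = fun _ => X.toAmbient f := by
        funext n
        rw [huv n, map_add]
        rfl
      rw [hc] at h0
      have h1 : X.toAmbient f = 0 := tendsto_nhds_unique tendsto_const_nhds h0
      exact Subtype.ext h1
    · rintro rfl
      refine le_antisymm ?_ (X.norm_nonneg' 0)
      have := X.norm_le_of_eq (f := 0) (f₀ := 0) (f₁ := 0) (by simp)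
      simpa using this

variable [IsTopologicalAddGroup 𝒳] [ContinuousSMul 𝕜 𝒳] [T2Space 𝒳]

noncomputable instance (X : CompatibleCouple 𝕜 X₀ X₁ 𝒳) : NormedAddCommGroup X.SumSpace :=
  NormedAddCommGroup.ofCore X.sumSpace_core

noncomputable instance (X : CompatibleCouple 𝕜 X₀ X₁ 𝒳) : NormedSpace 𝕜 X.SumSpace :=
  NormedSpace.ofCore X.sumSpace_core

/-- `X₀ + X₁` as a real normed space, for integration with respect to a real variable. -/
noncomputable instance (X : CompatibleCouple 𝕜 X₀ X₁ 𝒳) : NormedSpace ℝ X.SumSpace :=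
  NormedSpace.restrictScalars ℝ 𝕜 X.SumSpace

/-- `X₀ + X₁` is a Banach space, so that the Bochner integral below is the genuine one. -/
instance [CompleteSpace X₀] [CompleteSpace X₁] (X : CompatibleCouple 𝕜 X₀ X₁ 𝒳) :
    CompleteSpace X.SumSpace := by
  refine NormedAddCommGroup.completeSpace_of_summable_imp_tendsto fun w hw => ?_
  choose u v huv hlt using fun n : ℕ =>
    X.exists_decomp_lt (w n) (show (0 : ℝ) < (1 / 2) ^ n by positivity)
  have hs : Summable fun n => ‖w n‖ + (1 / 2 : ℝ) ^ n := hw.add summable_geometric_two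
  have hu : Summable u := Summable.of_norm_bounded hs
    fun n => by linarith [hlt n, norm_nonneg (v n)]
  have hv : Summable v := Summable.of_norm_bounded hs
    fun n => by linarith [hlt n, norm_nonneg (u n)]
  refine ⟨X.incl₀ (∑' n, u n) + X.incl₁ (∑' n, v n), ?_⟩
  have hu' := hu.hasSum.tendsto_sum_nat
  have hv' := hv.hasSum.tendsto_sum_nat
  rw [tendsto_iff_norm_sub_tendsto_zero] at hu' hv' ⊢
  refine squeeze_zero (fun n => norm_nonneg _) (fun n => ?_) (by simpa using hu'.add hv')
  refine X.norm_le_of_eq ?_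
  simp only [map_sub, map_sum]
  rw [Finset.sum_congr rfl fun i _ => huv i, Finset.sum_add_distrib]
  abel

end Basic

section Spaces

variable {𝕜 X₀ X₁ 𝒳 : Type*} [RCLike 𝕜]
  [NormedAddCommGroup X₀] [NormedSpace 𝕜 X₀] [NormedAddCommGroup X₁] [NormedSpace 𝕜 X₁]
  [AddCommGroup 𝒳] [Module 𝕜 𝒳] [TopologicalSpace 𝒳]
  [IsTopologicalAddGroup 𝒳] [ContinuousSMul 𝕜 𝒳] [T2Space 𝒳]

/-- The functional `‖f‖_{θ,q,v;K} = ‖t^{-θ-1/q} v(t) K(f,t;X₀,X₁)‖_{q,(0,∞)}` (for `q = ∞` one has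
`q.toReal⁻¹ = 0` and the norm is the essential supremum). The space `(X₀, X₁)_{θ,q,v;K}` is the set
of the `f ∈ X₀ + X₁` at which it is finite. -/
noncomputable def kNorm (X : CompatibleCouple 𝕜 X₀ X₁ 𝒳) (θ : ℝ) (q : ℝ≥0∞) (v : ℝ → ℝ≥0∞)
    (f : X.SumSpace) : ℝ≥0∞ :=
  eLpNorm (fun t : ℝ => ENNReal.ofReal (t ^ (-θ - q.toReal⁻¹)) * v t * ENNReal.ofReal (X.K f t)) q
    (volume.restrict (Ioi 0))

/-- `u : (0,∞) → X₀ ∩ X₁` is strongly measurable and `f = ∫₀^∞ u(s) ds/s`, as a convergent (Bochner)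
integral in `X₀ + X₁`. -/
def Represents (X : CompatibleCouple 𝕜 X₀ X₁ 𝒳) (u : ℝ → X.interSpace) (f : X.SumSpace) : Prop :=
  AEStronglyMeasurable u (volume.restrict (Ioi 0)) ∧
  IntegrableOn (fun s : ℝ => s⁻¹ • X.interToSum (u s)) (Ioi 0) ∧
  f = ∫ s in Ioi (0 : ℝ), s⁻¹ • X.interToSum (u s)

/-- The functional `‖f‖_{θ,q,v;J} = inf ‖t^{-θ-1/q} v(t) J(u(t),t;X₀,X₁)‖_{q,(0,∞)}`, the infimum
being over all representations `f = ∫₀^∞ u(s) ds/s`; it is `∞` if there is none. The space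
`(X₀, X₁)_{θ,q,v;J}` is the set of the `f ∈ X₀ + X₁` at which it is finite. The product of the
weight and the `J`-functional follows the convention `∞ · 0 = 0`. -/
noncomputable def jNorm (X : CompatibleCouple 𝕜 X₀ X₁ 𝒳) (θ : ℝ) (q : ℝ≥0∞) (v : ℝ → ℝ≥0∞)
    (f : X.SumSpace) : ℝ≥0∞ :=
  ⨅ (u : ℝ → X.interSpace) (_ : X.Represents u f),
    eLpNorm
      (fun t : ℝ => ENNReal.ofReal (t ^ (-θ - q.toReal⁻¹)) * v t * ENNReal.ofReal (X.J (u t) t)) q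
      (volume.restrict (Ioi 0))

/-- For a space `Y ⊆ X₀ + X₁` with (extended) norm `N`, the norm of the sum `X₀ + Y`:
the infimum of `‖f₀‖_{X₀} + N g` over all `f = f₀ + g`; it is finite exactly on `X₀ + Y`. -/
noncomputable def addX₀ (X : CompatibleCouple 𝕜 X₀ X₁ 𝒳) (N : X.SumSpace → ℝ≥0∞)
    (f : X.SumSpace) : ℝ≥0∞ :=
  ⨅ (f₀ : X₀) (g : X.SumSpace) (_ : f = X.incl₀ f₀ + g), ‖f₀‖ₑ + N g

/-- The spaces `{f | N f < ∞}` and `{f | N' f < ∞}` are equal as sets and `N`, `N'` are equivalent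
norms on them. -/
def Coincide (X : CompatibleCouple 𝕜 X₀ X₁ 𝒳) (N N' : X.SumSpace → ℝ≥0∞) : Prop :=
  {f | N f < ∞} = {f | N' f < ∞} ∧
  ∃ c C : ℝ, 0 < c ∧ 0 < C ∧ ∀ f : X.SumSpace, N f < ∞ →
    ENNReal.ofReal c * N' f ≤ N f ∧ N f ≤ ENNReal.ofReal C * N' f

end Spaces

end CompatibleCouple

/-- `f` and `g` are equivalent on `(0,∞)`: each is bounded by a positive constant multiple of the
other. -/
def EquivOnIoi (f g : ℝ → ℝ) : Prop :=
  ∃ c C : ℝ, 0 < c ∧ 0 < C ∧ ∀ t, 0 < t → c * g t ≤ f t ∧ f t ≤ C * g t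

/-- The class `SV(0,∞)` of slowly varying functions. -/
structure SlowlyVarying (b : ℝ → ℝ) : Prop where
  pos : ∀ t, 0 < t → 0 < b t
  measurable : AEMeasurable b (volume.restrict (Ioi 0))
  monotone : ∀ ε : ℝ, 0 < ε →
    ∃ g : ℝ → ℝ, MonotoneOn g (Ioi 0) ∧ EquivOnIoi (fun t => t ^ ε * b t) g
  antitone : ∀ ε : ℝ, 0 < ε →
    ∃ g : ℝ → ℝ, AntitoneOn g (Ioi 0) ∧ EquivOnIoi (fun t => t ^ (-ε) * b t) g

/-- The class `AC(0,∞)`: absolute continuity on every compact subinterval of `(0,∞)`. (The functions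
of interest may be unbounded at `0`.) -/
def ACIoi (b : ℝ → ℝ) : Prop :=
  ∀ x y : ℝ, 0 < x → x ≤ y → AbsolutelyContinuousOnInterval b x y

/-! Put `a = 1/B`. Gluing makes `B` strictly decreasing from `∞` to `0`, so `a` increases from `0`
to `∞`, and slow variation gives `a(s)√t ≤ C a(t)√s` for `t ≤ s`. The second equality holds even
before `X₀` is added: the `K`-space of `B` and the `J`-space of `A` coincide. A `K`-norm at most `M`
means `K(g,t) ≤ M a(t)`. As `a' = -B'/B²`, the weight `A(s)` is `1/(s a'(s))`, so the `J`-condition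
reads `J(u(s),s) ≤ M s a'(s)` a.e.

From `J` to `K` (`K_le_of_represents`), cut `∫ u(s) ds/s` at `t`. The part below `t` has `X₀`-norm
at most `M ∫₀ᵗ a' ≤ M a(t)`. The part above has `X₁`-norm at most `M ∫ₜ^∞ a'(s)/s ds`, which the
growth bound makes `O(M a(t)/t)`.

From `K` to `J` (`exists_represents`), take nearly optimal decompositions at the points where `a =
2^k`. The differences of consecutive `X₀`-parts lie in `X₀ ∩ X₁` and telescope to `g`. Each is
spread over one block with density `a'/2^k`, of total mass one.

The first equality is elementary. Since `b` is bounded and `b ≤ D B`, the sum embeds in the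
`K`-space of `b`. Conversely, a nearly optimal decomposition `f = f₀ + f₁` at `t = 1` works:
`K(f₁,t) ≤ t‖f₁‖` handles `t < 1`, where `t B(t)` is bounded, and `K(f₁,t) ≤ ‖f₀‖ + K(f,t)` handles
`t ≥ 1`, where `B = b`. -/

/-! ### Slow variation and local absolute continuity. -/

theorem SlowlyVarying.exists_rpow_mul_le {b : ℝ → ℝ} (hb : SlowlyVarying b) {ε : ℝ} (hε : 0 < ε) :
    ∃ E : ℝ, 0 < E ∧ ∀ t s, 0 < t → t ≤ s → t ^ ε * b t ≤ E * (s ^ ε * b s) := by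
  obtain ⟨g, hg, c, C, hc, hC, h⟩ := hb.monotone ε hε
  refine ⟨C / c, by positivity, fun t s ht hts => ?_⟩
  have hs : 0 < s := ht.trans_le hts
  have h1 := (h t ht).2
  have h2 := (h s hs).1
  have h3 := hg (mem_Ioi.2 ht) (mem_Ioi.2 hs) hts
  calc t ^ ε * b t ≤ C * g s := h1.trans (by gcongr)
    _ = C / c * (c * g s) := by field_simp
    _ ≤ _ := by gcongr

/-- Inversion is Lipschitz on `[m, ∞)` with constant `m⁻²`. -/
theorem AbsolutelyContinuousOnInterval.inv₀ {f : ℝ → ℝ} {x y m : ℝ}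
    (hf : AbsolutelyContinuousOnInterval f x y) (hm : 0 < m) (h : ∀ z ∈ uIcc x y, m ≤ f z) :
    AbsolutelyContinuousOnInterval (fun z => (f z)⁻¹) x y := by
  rw [absolutelyContinuousOnInterval_iff] at hf ⊢
  intro ε hε
  obtain ⟨δ, hδ, H⟩ := hf (m ^ 2 * ε) (by positivity)
  refine ⟨δ, hδ, fun E hE hlt => ?_⟩
  have h1 := H E hE hlt
  have h2 : ∑ i ∈ Finset.range E.1, dist (f (E.2 i).1)⁻¹ (f (E.2 i).2)⁻¹ ≤
      ∑ i ∈ Finset.range E.1, (m ^ 2)⁻¹ * dist (f (E.2 i).1) (f (E.2 i).2) := by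
    refine Finset.sum_le_sum fun i hi => ?_
    obtain ⟨hp, hq⟩ := hE.1 i hi
    have hp' := h _ hp
    have hq' := h _ hq
    have hp0 : 0 < f (E.2 i).1 := hm.trans_le hp'
    have hq0 : 0 < f (E.2 i).2 := hm.trans_le hq'
    rw [Real.dist_eq, Real.dist_eq, inv_sub_inv hp0.ne' hq0.ne', abs_div,
      abs_of_pos (mul_pos hp0 hq0), abs_sub_comm, div_eq_inv_mul]
    gcongr
    rw [sq]
    exact mul_le_mul hp' hq' hm.le hp0.le
  rw [← Finset.mul_sum] at h2
  refine h2.trans_lt ?_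
  rw [inv_mul_lt_iff₀ (by positivity)]
  exact h1

theorem ACIoi.continuousOn {b : ℝ → ℝ} (h : ACIoi b) : ContinuousOn b (Ioi 0) := by
  intro x hx
  have hx' : (0 : ℝ) < x := hx
  have h1 := (h (x / 2) (2 * x) (by positivity) (by linarith)).continuousOn
  rw [uIcc_of_le (by linarith)] at h1
  exact (h1.continuousAt (Icc_mem_nhds (by linarith) (by linarith))).continuousWithinAt

/-! ### Growth functions and integrals of their derivatives. -/

/-- Increasing functions from `0` to `∞` on `(0,∞)`, locally absolutely continuous, growing at most
like a square root. -/
structure GrowthFunction (a : ℝ → ℝ) (C : ℝ) : Prop where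
  pos : ∀ t, 0 < t → 0 < a t
  strictMonoOn : StrictMonoOn a (Ioi 0)
  ac : ACIoi a
  tendsto_zero : Tendsto a (𝓝[>] 0) (𝓝 0)
  tendsto_atTop : Tendsto a atTop atTop
  growth : ∀ t s, 0 < t → t ≤ s → a s * √t ≤ C * (a t * √s)

namespace GrowthFunction

variable {a : ℝ → ℝ} {C : ℝ}

theorem const_pos (h : GrowthFunction a C) : 0 < C := by
  have h1 := h.growth 1 1 one_pos le_rfl
  have h2 := h.pos 1 one_pos
  simp only [Real.sqrt_one, mul_one] at h1
  nlinarith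

theorem continuousOn (h : GrowthFunction a C) : ContinuousOn a (Ioi 0) :=
  h.ac.continuousOn

theorem exists_eq (h : GrowthFunction a C) {v : ℝ} (hv : 0 < v) : ∃ t, 0 < t ∧ a t = v := by
  obtain ⟨t, ht, rfl⟩ := isPreconnected_Ioi.intermediate_value_Ioi (s := Ioi (0 : ℝ))
    (l₁ := 𝓝[>] 0) (l₂ := atTop) inf_le_right (le_principal_iff.2 (Ioi_mem_atTop 0))
    h.continuousOn h.tendsto_zero h.tendsto_atTop hv
  exact ⟨t, ht, rfl⟩

theorem deriv_nonneg (h : GrowthFunction a C) {t : ℝ} (ht : 0 < t) : 0 ≤ deriv a t := by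
  rw [← derivWithin_of_isOpen isOpen_Ioi (mem_Ioi.2 ht)]
  exact h.strictMonoOn.monotoneOn.derivWithin_nonneg

theorem integral_deriv_Ioc (h : GrowthFunction a C) {x y : ℝ} (hx : 0 < x) (hxy : x ≤ y) :
    ∫ s in Ioc x y, deriv a s = a y - a x := by
  rw [← intervalIntegral.integral_of_le hxy, (h.ac x y hx hxy).integral_deriv_eq_sub]

theorem integrableOn_deriv_Ioc (h : GrowthFunction a C) {x y : ℝ} (hx : 0 < x) (hxy : x ≤ y) :
    IntegrableOn (deriv a) (Ioc x y) :=
  (intervalIntegrable_iff_integrableOn_Ioc_of_le hxy).1 (h.ac x y hx hxy).intervalIntegrable_deriv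

theorem lintegral_deriv_Ioc (h : GrowthFunction a C) {x y : ℝ} (hx : 0 < x) (hxy : x ≤ y) :
    ∫⁻ s in Ioc x y, ENNReal.ofReal (deriv a s) = ENNReal.ofReal (a y - a x) := by
  rw [← h.integral_deriv_Ioc hx hxy, ofReal_integral_eq_lintegral_ofReal
    (h.integrableOn_deriv_Ioc hx hxy)]
  filter_upwards [ae_restrict_mem measurableSet_Ioc] with s hs
  exact h.deriv_nonneg (hx.trans hs.1)

theorem lintegral_deriv_Ioc_zero_le (h : GrowthFunction a C) {t : ℝ} (ht : 0 < t) :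
    ∫⁻ s in Ioc 0 t, ENNReal.ofReal (deriv a s) ≤ ENNReal.ofReal (a t) := by
  have hU : Ioc 0 t = ⋃ n : ℕ, Ioc (t / ((n : ℝ) + 1)) t := by
    ext s
    simp only [mem_Ioc, mem_iUnion]
    constructor
    · rintro ⟨hs, hst⟩
      obtain ⟨n, hn⟩ := exists_nat_gt (t / s)
      refine ⟨n, ?_, hst⟩
      rw [div_lt_iff₀ hs] at hn
      rw [div_lt_iff₀ (by positivity)]
      nlinarith
    · rintro ⟨n, hs, hst⟩
      exact ⟨lt_trans (by positivity) hs, hst⟩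
  have hmono : Monotone fun n : ℕ => Ioc (t / ((n : ℝ) + 1)) t := by
    intro m n hmn
    refine Ioc_subset_Ioc_left ?_
    have : (m : ℝ) ≤ n := by exact_mod_cast hmn
    gcongr
  rw [hU, setLIntegral_iUnion_of_directed _ hmono.directed_le]
  refine iSup_le fun n => ?_
  have hn : 0 < t / ((n : ℝ) + 1) := by positivity
  rw [h.lintegral_deriv_Ioc hn (div_le_self ht.le (by linarith [n.cast_nonneg (α := ℝ)]))]
  exact ENNReal.ofReal_le_ofReal (by linarith [h.pos _ hn])

theorem le_of_four_pow (h : GrowthFunction a C) {t : ℝ} (ht : 0 < t) (n : ℕ) :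
    a (4 ^ n * t) ≤ C * 2 ^ n * a t := by
  have h1 : (1 : ℝ) ≤ 4 ^ n := one_le_pow₀ (by norm_num)
  have h2 := h.growth t (4 ^ n * t) ht (by nlinarith)
  have h3 : √(4 ^ n * t) = 2 ^ n * √t := by
    rw [Real.sqrt_mul (by positivity), show (4 : ℝ) ^ n = (2 ^ n) ^ 2 by
      rw [← pow_mul, mul_comm n 2, pow_mul]; norm_num, Real.sqrt_sq (by positivity)]
  rw [h3] at h2
  have h4 : 0 < √t := Real.sqrt_pos.2 ht
  refine le_of_mul_le_mul_right ?_ h4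
  linarith

/-- On the block from `4^n t` to `4^(n+1) t` the increment of `a` is at most `C 2^(n+1) a(t)` while
`1/s ≤ 1/(4^n t)`. The blocks thus contribute a geometric series of ratio `1/2`; any growth exponent
below one would do. -/
theorem lintegral_deriv_div_Ioi_le (h : GrowthFunction a C) {t : ℝ} (ht : 0 < t) :
    ∫⁻ s in Ioi t, ENNReal.ofReal (deriv a s / s) ≤ ENNReal.ofReal (4 * C * (a t / t)) := by
  have hC := h.const_pos
  have hat := h.pos t ht
  have hU : Ioi t ⊆ ⋃ n : ℕ, Ico (4 ^ n * t) (4 ^ (n + 1) * t) := by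
    intro s hs
    obtain ⟨n, hn1, hn2⟩ := exists_nat_pow_near (x := s / t) (y := (4 : ℝ))
      ((one_lt_div ht).2 hs).le (by norm_num)
    refine mem_iUnion.2 ⟨n, ?_, ?_⟩
    · exact (le_div_iff₀ ht).1 hn1
    · exact (div_lt_iff₀ ht).1 hn2
  calc ∫⁻ s in Ioi t, ENNReal.ofReal (deriv a s / s)
      ≤ ∫⁻ s in ⋃ n : ℕ, Ico (4 ^ n * t) (4 ^ (n + 1) * t), ENNReal.ofReal (deriv a s / s) :=
        lintegral_mono_set hU
    _ ≤ ∑' n : ℕ, ∫⁻ s in Ico (4 ^ n * t) (4 ^ (n + 1) * t), ENNReal.ofReal (deriv a s / s) :=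
        lintegral_iUnion_le _ _
    _ ≤ ∑' n : ℕ, ENNReal.ofReal (2 * C * (a t / t) * (1 / 2) ^ n) := by
        refine ENNReal.tsum_le_tsum fun n => ?_
        have hx : 0 < 4 ^ n * t := by positivity
        have hxy : 4 ^ n * t ≤ 4 ^ (n + 1) * t := by rw [pow_succ]; linarith
        rw [setLIntegral_congr Ico_ae_eq_Ioc]
        calc ∫⁻ s in Ioc (4 ^ n * t) (4 ^ (n + 1) * t), ENNReal.ofReal (deriv a s / s)
            ≤ ∫⁻ s in Ioc (4 ^ n * t) (4 ^ (n + 1) * t),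
                ENNReal.ofReal (4 ^ n * t)⁻¹ * ENNReal.ofReal (deriv a s) := by
              refine setLIntegral_mono' measurableSet_Ioc fun s hs => ?_
              rw [← ENNReal.ofReal_mul (by positivity), div_eq_inv_mul]
              have := h.deriv_nonneg (hx.trans hs.1)
              have := hs.1.le
              gcongr
          _ = ENNReal.ofReal (4 ^ n * t)⁻¹ *
                ENNReal.ofReal (a (4 ^ (n + 1) * t) - a (4 ^ n * t)) := by
              rw [lintegral_const_mul' _ _ ENNReal.ofReal_ne_top, h.lintegral_deriv_Ioc hx hxy]
          _ ≤ _ := by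
              rw [← ENNReal.ofReal_mul (by positivity)]
              refine ENNReal.ofReal_le_ofReal ?_
              rw [inv_mul_le_iff₀ hx]
              have h1 := h.le_of_four_pow ht (n + 1)
              have h2 := h.pos _ hx
              have h3 : 4 ^ n * t * (2 * C * (a t / t) * (1 / 2) ^ n) = C * 2 ^ (n + 1) * a t := by
                rw [show (4 : ℝ) ^ n = 2 ^ n * 2 ^ n by rw [← mul_pow]; norm_num, one_div, inv_pow,
                  pow_succ]
                field_simp
              linarith
    _ = ENNReal.ofReal (4 * C * (a t / t)) := by
        rw [← ENNReal.ofReal_tsum_of_nonneg (fun n => by positivity)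
          (summable_geometric_two.mul_left _), tsum_mul_left, tsum_geometric_two]
        congr 1
        ring

end GrowthFunction

/-! ### The reciprocal of `B`, and extended-real bookkeeping. -/

theorem SlowlyVarying.exists_growthFunction_inv {B : ℝ → ℝ} (hB : SlowlyVarying B) (hac : ACIoi B)
    (hanti : StrictAntiOn B (Ioi 0)) (h0 : Tendsto B (𝓝[>] 0) atTop)
    (htop : Tendsto B atTop (𝓝 0)) : ∃ C, GrowthFunction (fun x => (B x)⁻¹) C := by
  -- The exponent `1/2` yields the square-root growth bound after inversion.
  obtain ⟨C, hC, h⟩ := hB.exists_rpow_mul_le (ε := 1 / 2) (by norm_num)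
  refine ⟨C, fun t ht => inv_pos.2 (hB.pos t ht), fun x hx y hy hxy => ?_, fun x y hx hxy => ?_,
    h0.inv_tendsto_atTop, ?_, fun t s ht hts => ?_⟩
  · exact inv_strictAnti₀ (hB.pos y hy) (hanti hx hy hxy)
  · refine (hac x y hx hxy).inv₀ (hB.pos y (hx.trans_le hxy)) fun z hz => ?_
    rw [uIcc_of_le hxy] at hz
    exact hanti.antitoneOn (hx.trans_le hz.1) (hx.trans_le hxy) hz.2
  · refine Tendsto.inv_tendsto_nhdsGT_zero (tendsto_nhdsWithin_iff.2 ⟨htop, ?_⟩)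
    filter_upwards [Ioi_mem_atTop 0] with x hx using hB.pos x hx
  · have h1 := h t s ht hts
    have h2 := hB.pos t ht
    have h3 := hB.pos s (ht.trans_le hts)
    rw [← Real.sqrt_eq_rpow, ← Real.sqrt_eq_rpow] at h1
    rw [inv_mul_eq_div, inv_mul_eq_div, mul_div_assoc', div_le_div_iff₀ h3 h2]
    linarith

/-- No differentiability is needed: `B` and `1/B` fail to be differentiable at the same points, and
there both sides take the default value `0`. -/
theorem deriv_inv_of_pos {B : ℝ → ℝ} {x : ℝ} (hx : 0 < B x) :
    deriv (fun y => (B y)⁻¹) x = -deriv B x / B x ^ 2 := by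
  by_cases hd : DifferentiableAt ℝ B x
  · exact deriv_fun_inv'' hd hx.ne'
  · rw [deriv_zero_of_not_differentiableAt hd, deriv_zero_of_not_differentiableAt]
    · simp
    · intro h
      refine hd ?_
      simpa using h.fun_inv (inv_ne_zero hx.ne')

/-- This turns the weighted bound with `A` into a real inequality. When `p = 0` the weight is `∞`,
and `∞ · 0 = 0` makes both sides say `j = 0`. -/
theorem ENNReal.ofReal_div_mul_le_iff {p q j M : ℝ} (hq : 0 < q) (hp : 0 ≤ p) (hj : 0 ≤ j)
    (hM : 0 ≤ M) :
    ENNReal.ofReal q / ENNReal.ofReal p * ENNReal.ofReal j ≤ ENNReal.ofReal M ↔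
      j ≤ M * (p / q) := by
  rcases hp.eq_or_lt with rfl | hp
  · rw [ENNReal.ofReal_zero, ENNReal.div_zero (by simpa using hq), zero_div, mul_zero]
    rcases hj.eq_or_lt with rfl | hj
    · simp
    · rw [ENNReal.top_mul (by simpa using hj)]
      simp [hj]
  · rw [← ENNReal.ofReal_div_of_pos hp, ← ENNReal.ofReal_mul (by positivity),
      ENNReal.ofReal_le_ofReal_iff hM, ← le_div_iff₀' (by positivity)]
    rw [show M * (p / q) = M / (q / p) by field_simp]

/-- Reduces every norm estimate below to real bounds `M > 0`; an arbitrarily small excess covers the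
case `x = 0`. -/
theorem ENNReal.le_ofReal_mul_of_forall_real {x y : ℝ≥0∞} {C : ℝ} (hC : 0 < C)
    (h : ∀ M : ℝ, 0 < M → x ≤ ENNReal.ofReal M → y ≤ ENNReal.ofReal (C * M)) :
    y ≤ ENNReal.ofReal C * x := by
  rcases eq_or_ne x ⊤ with rfl | hx
  · rw [ENNReal.mul_top (by simpa using hC)]
    exact le_top
  refine ENNReal.le_of_forall_pos_le_add fun ε hε _ => ?_
  have hε' : (0 : ℝ) < ε := hε
  have hx0 := ENNReal.toReal_nonneg (a := x)
  refine (h (x.toReal + ε / C) (by positivity) ?_).trans ?_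
  · rw [← ENNReal.ofReal_toReal hx]
    exact ENNReal.ofReal_le_ofReal (by rw [ENNReal.toReal_ofReal hx0]; linarith [div_pos hε' hC])
  · rw [mul_add, mul_div_cancel₀ _ hC.ne', ENNReal.ofReal_add (by positivity) hε'.le,
      ENNReal.ofReal_mul hC.le, ENNReal.ofReal_toReal hx, ENNReal.ofReal_coe_nnreal]

/-! ### Elementary estimates for the `K`- and `J`-functionals. -/

namespace CompatibleCouple

section Basic

variable {𝕜 X₀ X₁ 𝒳 : Type*} [RCLike 𝕜]
  [NormedAddCommGroup X₀] [NormedSpace 𝕜 X₀] [NormedAddCommGroup X₁] [NormedSpace 𝕜 X₁]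
  [AddCommGroup 𝒳] [Module 𝕜 𝒳] [TopologicalSpace 𝒳]

theorem K_le (X : CompatibleCouple 𝕜 X₀ X₁ 𝒳) {f : X.SumSpace} {f₀ : X₀} {f₁ : X₁}
    (h : f = X.incl₀ f₀ + X.incl₁ f₁) {t : ℝ} (ht : 0 ≤ t) : X.K f t ≤ ‖f₀‖ + t * ‖f₁‖ := by
  refine csInf_le ⟨0, ?_⟩ ⟨f₀, f₁, h, rfl⟩
  rintro r ⟨g₀, g₁, -, rfl⟩
  positivity

theorem K_nonneg (X : CompatibleCouple 𝕜 X₀ X₁ 𝒳) (f : X.SumSpace) {t : ℝ} (ht : 0 ≤ t) :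
    0 ≤ X.K f t := by
  refine Real.sInf_nonneg ?_
  rintro r ⟨g₀, g₁, -, rfl⟩
  positivity

theorem exists_decomp_of_K_lt (X : CompatibleCouple 𝕜 X₀ X₁ 𝒳) {f : X.SumSpace} {t r : ℝ}
    (h : X.K f t < r) :
    ∃ (f₀ : X₀) (f₁ : X₁), f = X.incl₀ f₀ + X.incl₁ f₁ ∧ ‖f₀‖ + t * ‖f₁‖ < r := by
  obtain ⟨f₀, f₁, hf⟩ := X.exists_decomp f
  obtain ⟨_, ⟨g₀, g₁, hg, rfl⟩, hr⟩ := exists_lt_of_csInf_lt (by exact ⟨_, f₀, f₁, hf, rfl⟩) h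
  exact ⟨g₀, g₁, hg, hr⟩

theorem K_mono (X : CompatibleCouple 𝕜 X₀ X₁ 𝒳) (f : X.SumSpace) {s t : ℝ} (hs : 0 ≤ s)
    (hst : s ≤ t) : X.K f s ≤ X.K f t := by
  refine le_of_forall_gt fun r hr => ?_
  obtain ⟨f₀, f₁, hf, hlt⟩ := X.exists_decomp_of_K_lt hr
  refine (X.K_le hf hs).trans_lt (lt_of_le_of_lt ?_ hlt)
  gcongr

theorem K_incl₀_add_le (X : CompatibleCouple 𝕜 X₀ X₁ 𝒳) (x : X₀) (g : X.SumSpace) {t : ℝ}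
    (ht : 0 ≤ t) : X.K (X.incl₀ x + g) t ≤ ‖x‖ + X.K g t := by
  refine le_of_forall_gt fun r hr => ?_
  obtain ⟨f₀, f₁, hf, hlt⟩ := X.exists_decomp_of_K_lt (show X.K g t < r - ‖x‖ by linarith)
  have h : X.incl₀ x + g = X.incl₀ (x + f₀) + X.incl₁ f₁ := by rw [hf, map_add, add_assoc]
  linarith [X.K_le h ht, norm_add_le x f₀]

theorem interToSum_eq_incl₁ (X : CompatibleCouple 𝕜 X₀ X₁ 𝒳) (w : X.interSpace) :
    X.interToSum w = X.incl₁ (w : X₀ × X₁).2 := Subtype.ext w.2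

theorem J_nonneg (X : CompatibleCouple 𝕜 X₀ X₁ 𝒳) (w : X.interSpace) (t : ℝ) : 0 ≤ X.J w t :=
  le_max_of_le_left (norm_nonneg _)

theorem J_smul (X : CompatibleCouple 𝕜 X₀ X₁ 𝒳) (c : 𝕜) (w : X.interSpace) (t : ℝ) :
    X.J (c • w) t = ‖c‖ * X.J w t := by
  simp only [J, Submodule.coe_smul, Prod.smul_fst, Prod.smul_snd, norm_smul]
  rw [mul_max_of_nonneg _ _ (norm_nonneg c), mul_left_comm]

theorem norm_incl₀_le (X : CompatibleCouple 𝕜 X₀ X₁ 𝒳) (x : X₀) : ‖X.incl₀ x‖ ≤ ‖x‖ := by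
  simpa using X.norm_le_of_eq (f := X.incl₀ x) (f₀ := x) (f₁ := 0) (by simp)

theorem norm_incl₁_le (X : CompatibleCouple 𝕜 X₀ X₁ 𝒳) (x : X₁) : ‖X.incl₁ x‖ ≤ ‖x‖ := by
  simpa using X.norm_le_of_eq (f := X.incl₁ x) (f₀ := 0) (f₁ := x) (by simp)

variable {a : ℝ → ℝ} {C M : ℝ}

/-- `J` dominates the `X₀`-norm, so the integrand is bounded by `M a'(s)`, integrable near `0`. -/
theorem integrableOn_fst (X : CompatibleCouple 𝕜 X₀ X₁ 𝒳) (ha : GrowthFunction a C)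
    {u : ℝ → X.interSpace} (hu : AEStronglyMeasurable u (volume.restrict (Ioi 0)))
    (hM : 0 ≤ M) (hJ : ∀ᵐ s ∂(volume.restrict (Ioi (0 : ℝ))), X.J (u s) s ≤ M * (s * deriv a s))
    {t : ℝ} (ht : 0 < t) :
    IntegrableOn (fun s : ℝ => ((s⁻¹ : ℝ) : 𝕜) • (u s : X₀ × X₁).1) (Ioc 0 t) ∧
      ∫⁻ s in Ioc 0 t, ‖((s⁻¹ : ℝ) : 𝕜) • (u s : X₀ × X₁).1‖ₑ ≤ ENNReal.ofReal (M * a t) := by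
  have hle : ∫⁻ s in Ioc 0 t, ‖((s⁻¹ : ℝ) : 𝕜) • (u s : X₀ × X₁).1‖ₑ ≤
      ENNReal.ofReal (M * a t) := by
    calc _ ≤ ∫⁻ s in Ioc 0 t, ENNReal.ofReal M * ENNReal.ofReal (deriv a s) := by
          refine lintegral_mono_ae ?_
          filter_upwards [ae_restrict_of_ae_restrict_of_subset Ioc_subset_Ioi_self hJ,
            ae_restrict_mem measurableSet_Ioc] with s hs hs'
          rw [← ENNReal.ofReal_mul hM, ← ofReal_norm]
          refine ENNReal.ofReal_le_ofReal ?_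
          rw [norm_smul, RCLike.norm_ofReal, abs_of_pos (inv_pos.2 hs'.1), inv_mul_le_iff₀ hs'.1]
          calc _ ≤ _ := (le_max_left _ _).trans hs
            _ = _ := by ring
      _ = ENNReal.ofReal M * ∫⁻ s in Ioc 0 t, ENNReal.ofReal (deriv a s) :=
          lintegral_const_mul' _ _ ENNReal.ofReal_ne_top
      _ ≤ _ := by
          rw [ENNReal.ofReal_mul hM]
          gcongr
          exact ha.lintegral_deriv_Ioc_zero_le ht
  refine ⟨⟨?_, hle.trans_lt ENNReal.ofReal_lt_top⟩, hle⟩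
  refine AEStronglyMeasurable.smul
    (RCLike.continuous_ofReal.measurable.comp measurable_inv).aestronglyMeasurable ?_
  exact (continuous_fst.comp continuous_subtype_val).comp_aestronglyMeasurable
    (hu.mono_measure (Measure.restrict_mono Ioc_subset_Ioi_self le_rfl))

/-- `J` dominates `s` times the `X₁`-norm. This gains a factor `1/s`, and `M a'(s)/s` is integrable
near `∞`. -/
theorem integrableOn_snd (X : CompatibleCouple 𝕜 X₀ X₁ 𝒳) (ha : GrowthFunction a C)
    {u : ℝ → X.interSpace} (hu : AEStronglyMeasurable u (volume.restrict (Ioi 0)))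
    (hM : 0 ≤ M) (hJ : ∀ᵐ s ∂(volume.restrict (Ioi (0 : ℝ))), X.J (u s) s ≤ M * (s * deriv a s))
    {t : ℝ} (ht : 0 < t) :
    IntegrableOn (fun s : ℝ => ((s⁻¹ : ℝ) : 𝕜) • (u s : X₀ × X₁).2) (Ioi t) ∧
      ∫⁻ s in Ioi t, ‖((s⁻¹ : ℝ) : 𝕜) • (u s : X₀ × X₁).2‖ₑ ≤
        ENNReal.ofReal (M * (4 * C * (a t / t))) := by
  have hsub : Ioi t ⊆ Ioi 0 := Ioi_subset_Ioi ht.le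
  have hle : ∫⁻ s in Ioi t, ‖((s⁻¹ : ℝ) : 𝕜) • (u s : X₀ × X₁).2‖ₑ ≤
      ENNReal.ofReal (M * (4 * C * (a t / t))) := by
    calc _ ≤ ∫⁻ s in Ioi t, ENNReal.ofReal M * ENNReal.ofReal (deriv a s / s) := by
          refine lintegral_mono_ae ?_
          filter_upwards [ae_restrict_of_ae_restrict_of_subset hsub hJ,
            ae_restrict_mem measurableSet_Ioi] with s hs hs'
          have hs0 : 0 < s := ht.trans hs'
          rw [← ENNReal.ofReal_mul hM, ← ofReal_norm]
          refine ENNReal.ofReal_le_ofReal ?_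
          rw [norm_smul, RCLike.norm_ofReal, abs_of_pos (inv_pos.2 hs0), inv_mul_le_iff₀ hs0]
          have h1 : s * ‖(u s : X₀ × X₁).2‖ ≤ M * (s * deriv a s) := (le_max_right _ _).trans hs
          rw [show s * (M * (deriv a s / s)) = M * deriv a s by field_simp]
          refine le_of_mul_le_mul_left ?_ hs0
          linarith
      _ = ENNReal.ofReal M * ∫⁻ s in Ioi t, ENNReal.ofReal (deriv a s / s) :=
          lintegral_const_mul' _ _ ENNReal.ofReal_ne_top
      _ ≤ _ := by
          rw [ENNReal.ofReal_mul hM]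
          gcongr
          exact ha.lintegral_deriv_div_Ioi_le ht
  refine ⟨⟨?_, hle.trans_lt ENNReal.ofReal_lt_top⟩, hle⟩
  refine AEStronglyMeasurable.smul
    (RCLike.continuous_ofReal.measurable.comp measurable_inv).aestronglyMeasurable ?_
  exact (continuous_snd.comp continuous_subtype_val).comp_aestronglyMeasurable
    (hu.mono_measure (Measure.restrict_mono hsub le_rfl))

/-- The essential supremum is a pointwise one: if the bound fails at `t`, continuity of `w` and
monotonicity of `K` make it fail on an interval to the right of `t`, a set of positive measure. -/
theorem kNorm_le_ofReal_iff (X : CompatibleCouple 𝕜 X₀ X₁ 𝒳) {w : ℝ → ℝ}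
    (hw : ContinuousOn w (Ioi 0)) (hw0 : ∀ t, 0 < t → 0 < w t) {f : X.SumSpace} (hM : 0 ≤ M) :
    X.kNorm 0 ∞ (fun t => ENNReal.ofReal (w t)) f ≤ ENNReal.ofReal M ↔
      ∀ t, 0 < t → w t * X.K f t ≤ M := by
  have key : X.kNorm 0 ∞ (fun t => ENNReal.ofReal (w t)) f =
      essSup (fun t => ENNReal.ofReal (w t) * ENNReal.ofReal (X.K f t))
        (volume.restrict (Ioi 0)) := by
    simp [kNorm, eLpNorm_exponent_top, eLpNormEssSup]
  rw [key]
  constructor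
  · intro h t ht
    have hae : ∀ᵐ s ∂(volume.restrict (Ioi (0 : ℝ))), w s * X.K f s ≤ M := by
      filter_upwards [ENNReal.ae_le_essSup (μ := volume.restrict (Ioi (0 : ℝ)))
        (fun t => ENNReal.ofReal (w t) * ENNReal.ofReal (X.K f t)),
        ae_restrict_mem measurableSet_Ioi] with s hs hs'
      rw [← ENNReal.ofReal_mul (hw0 s hs').le] at hs
      exact (ENNReal.ofReal_le_ofReal_iff hM).1 (hs.trans h)
    by_contra! hlt
    have hev : ∀ᶠ s in 𝓝 t, M < w s * X.K f t :=
      ((hw.continuousAt (Ioi_mem_nhds ht)).mul continuousAt_const).eventually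
        (lt_mem_nhds hlt)
    obtain ⟨δ, hδ, hsub⟩ := mem_nhdsGT_iff_exists_Ioo_subset.1 (mem_nhdsWithin_of_mem_nhds hev)
    have hae' := ae_restrict_of_ae_restrict_of_subset
      (show Ioo t δ ⊆ Ioi 0 from fun s hs => ht.trans hs.1) hae
    have hfalse : ∀ᵐ s ∂(volume.restrict (Ioo t δ)), False := by
      filter_upwards [hae', ae_restrict_mem measurableSet_Ioo] with s hs hs'
      have h1 : M < w s * X.K f t := hsub hs'
      have h2 : w s * X.K f t ≤ w s * X.K f s :=
        mul_le_mul_of_nonneg_left (X.K_mono f ht.le hs'.1.le) (hw0 s (ht.trans hs'.1)).le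
      linarith
    rw [eventually_false_iff_eq_bot, ae_eq_bot, Measure.restrict_eq_zero, Real.volume_Ioo,
      ENNReal.ofReal_eq_zero] at hfalse
    have : t < δ := hδ
    linarith
  · intro h
    refine essSup_le_of_ae_le _ ?_
    filter_upwards [ae_restrict_mem measurableSet_Ioi] with s hs
    rw [← ENNReal.ofReal_mul (hw0 s hs).le]
    exact ENNReal.ofReal_le_ofReal (h s hs)

end Basic

/-! ### From `J`-bounds to `K`-bounds. -/

section Normed

variable {𝕜 X₀ X₁ 𝒳 : Type*} [RCLike 𝕜]
  [NormedAddCommGroup X₀] [NormedSpace 𝕜 X₀] [NormedAddCommGroup X₁] [NormedSpace 𝕜 X₁]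
  [AddCommGroup 𝒳] [Module 𝕜 𝒳] [TopologicalSpace 𝒳]
  [IsTopologicalAddGroup 𝒳] [ContinuousSMul 𝕜 𝒳] [T2Space 𝒳]

/-- The inclusion `X₀ ⊆ X₀ + X₁` as a continuous map. -/
noncomputable def inclL₀ (X : CompatibleCouple 𝕜 X₀ X₁ 𝒳) : X₀ →L[𝕜] X.SumSpace :=
  X.incl₀.mkContinuous 1 fun x => by simpa using X.norm_incl₀_le x

/-- The inclusion `X₁ ⊆ X₀ + X₁` as a continuous map. -/
noncomputable def inclL₁ (X : CompatibleCouple 𝕜 X₀ X₁ 𝒳) : X₁ →L[𝕜] X.SumSpace :=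
  X.incl₁.mkContinuous 1 fun x => by simpa using X.norm_incl₁_le x

theorem real_smul_eq (X : CompatibleCouple 𝕜 X₀ X₁ 𝒳) (r : ℝ) (f : X.SumSpace) :
    r • f = (r : 𝕜) • f := rfl

variable {a : ℝ → ℝ} {C M : ℝ}

theorem integrableOn_interToSum (X : CompatibleCouple 𝕜 X₀ X₁ 𝒳) (ha : GrowthFunction a C)
    {u : ℝ → X.interSpace} (hu : AEStronglyMeasurable u (volume.restrict (Ioi 0)))
    (hM : 0 ≤ M)
    (hJ : ∀ᵐ s ∂(volume.restrict (Ioi (0 : ℝ))), X.J (u s) s ≤ M * (s * deriv a s)) :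
    IntegrableOn (fun s : ℝ => s⁻¹ • X.interToSum (u s)) (Ioi 0) := by
  rw [← Ioc_union_Ioi_eq_Ioi zero_le_one]
  refine IntegrableOn.union ?_ ?_
  · refine (X.inclL₀.integrable_comp (X.integrableOn_fst ha hu hM hJ one_pos).1).congr ?_
    refine Eventually.of_forall fun s => ?_
    exact X.incl₀.map_smul _ _
  · refine (X.inclL₁.integrable_comp (X.integrableOn_snd ha hu hM hJ one_pos).1).congr ?_
    refine Eventually.of_forall fun s => ?_
    simp only [interToSum_eq_incl₁]
    exact X.incl₁.map_smul _ _

/-- Integrating over `(0,t]` in `X₀` and over `(t,∞)` in `X₁` gives a decomposition of `g`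
admissible for `K(g,t)`. -/
theorem K_le_of_represents [CompleteSpace X₀] [CompleteSpace X₁]
    (X : CompatibleCouple 𝕜 X₀ X₁ 𝒳) (ha : GrowthFunction a C)
    {u : ℝ → X.interSpace} {g : X.SumSpace} (hu : X.Represents u g) (hM : 0 ≤ M)
    (hJ : ∀ᵐ s ∂(volume.restrict (Ioi (0 : ℝ))), X.J (u s) s ≤ M * (s * deriv a s))
    {t : ℝ} (ht : 0 < t) : X.K g t ≤ (1 + 4 * C) * M * a t := by
  let _ : NormedSpace ℝ X₀ := NormedSpace.restrictScalars ℝ 𝕜 X₀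
  let _ : NormedSpace ℝ X₁ := NormedSpace.restrictScalars ℝ 𝕜 X₁
  obtain ⟨hum, hui, rfl⟩ := hu
  have hC := ha.const_pos
  have hat := ha.pos t ht
  obtain ⟨hi₀, hl₀⟩ := X.integrableOn_fst ha hum hM hJ ht
  obtain ⟨hi₁, hl₁⟩ := X.integrableOn_snd ha hum hM hJ ht
  have hdec : ∫ s in Ioi (0 : ℝ), s⁻¹ • X.interToSum (u s) =
      X.incl₀ (∫ s in Ioc 0 t, ((s⁻¹ : ℝ) : 𝕜) • (u s : X₀ × X₁).1) +
      X.incl₁ (∫ s in Ioi t, ((s⁻¹ : ℝ) : 𝕜) • (u s : X₀ × X₁).2) := by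
    have h0 := X.inclL₀.integral_comp_comm hi₀
    have h1 := X.inclL₁.integral_comp_comm hi₁
    rw [← Ioc_union_Ioi_eq_Ioi ht.le] at hui ⊢
    rw [setIntegral_union (Ioc_disjoint_Ioi le_rfl) measurableSet_Ioi
      (hui.mono_set subset_union_left) (hui.mono_set subset_union_right)]
    refine congrArg₂ _ (Eq.trans ?_ h0) (Eq.trans ?_ h1)
    · congr 1 with s
      exact (X.incl₀.map_smul _ _).symm
    · congr 1 with s
      rw [interToSum_eq_incl₁]
      exact (X.incl₁.map_smul _ _).symm
  have h0 : ‖∫ s in Ioc 0 t, ((s⁻¹ : ℝ) : 𝕜) • (u s : X₀ × X₁).1‖ ≤ M * a t := by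
    rw [← ENNReal.ofReal_le_ofReal_iff (by positivity), ofReal_norm]
    exact (enorm_integral_le_lintegral_enorm _).trans hl₀
  have h1 : ‖∫ s in Ioi t, ((s⁻¹ : ℝ) : 𝕜) • (u s : X₀ × X₁).2‖ ≤ M * (4 * C * (a t / t)) := by
    rw [← ENNReal.ofReal_le_ofReal_iff (by positivity), ofReal_norm]
    exact (enorm_integral_le_lintegral_enorm _).trans hl₁
  refine (X.K_le hdec ht.le).trans ?_
  calc _ ≤ M * a t + t * (M * (4 * C * (a t / t))) := by gcongr
    _ = _ := by field_simp

end Normed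

end CompatibleCouple

/-! ### Discretization and the fundamental lemma. -/

namespace GrowthFunction

variable {a : ℝ → ℝ} {C : ℝ}

/-- The blocks are the level sets of `⌊log₂ a⌋`, so the block index is a measurable function of `s`.
-/
theorem mem_Ico_iff_log_eq (h : GrowthFunction a C) {p q s : ℝ} {k : ℤ} (hp : 0 < p) (hq : 0 < q)
    (hap : a p = 2 ^ k) (haq : a q = 2 ^ (k + 1)) :
    s ∈ Ico p q ↔ 0 < s ∧ Int.log 2 (a s) = k := by
  have key : ∀ {s}, 0 < s → (s ∈ Ico p q ↔ Int.log 2 (a s) = k) := by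
    intro s hs
    have h1 := Int.zpow_le_iff_le_log (b := 2) one_lt_two (x := k) (h.pos s hs)
    have h2 := Int.lt_zpow_iff_log_lt (b := 2) one_lt_two (x := k + 1) (h.pos s hs)
    rw [Nat.cast_ofNat] at h1 h2
    rw [mem_Ico, ← h.strictMonoOn.le_iff_le hp hs, ← h.strictMonoOn.lt_iff_lt hs hq, hap, haq,
      h1, h2]
    omega
  constructor
  · intro hs
    have hs0 : 0 < s := hp.trans_le hs.1
    exact ⟨hs0, (key hs0).1 hs⟩
  · rintro ⟨hs0, hs⟩
    exact (key hs0).2 hs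

theorem aemeasurable_log (h : GrowthFunction a C) :
    AEMeasurable (fun s => Int.log 2 (a s)) (volume.restrict (Ioi 0)) := by
  refine aemeasurable_restrict_of_monotoneOn measurableSet_Ioi fun s hs t ht hst => ?_
  exact Int.log_mono_right (h.pos s hs) (h.strictMonoOn.monotoneOn hs ht hst)

/-- If `t k` is the point where `a` takes the value `2 ^ k`, then `2 ^ k / t k → 0`. -/
theorem tendsto_two_pow_div (h : GrowthFunction a C) {t : ℤ → ℝ} (ht : ∀ k, 0 < t k)
    (hat : ∀ k, a (t k) = 2 ^ k) :
    Tendsto (fun n : ℕ => (2 : ℝ) ^ (n : ℤ) / t n) atTop (𝓝 0) := by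
  have hC := h.const_pos
  have hlim : Tendsto (fun n : ℕ => C ^ 2 / t 0 * (1 / 2 : ℝ) ^ n) atTop (𝓝 0) := by
    simpa using (tendsto_pow_atTop_nhds_zero_of_lt_one (r := (1 / 2 : ℝ)) (by norm_num)
      (by norm_num)).const_mul (C ^ 2 / t 0)
  refine squeeze_zero (fun n => div_nonneg (by positivity) (ht n).le) (fun n => ?_) hlim
  have h0n : t 0 ≤ t n := by
    rw [← h.strictMonoOn.le_iff_le (ht 0) (ht n), hat, hat]
    exact zpow_le_zpow_right₀ one_le_two (by positivity)
  have h1 := h.growth (t 0) (t n) (ht 0) h0n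
  rw [hat, hat, zpow_zero, one_mul, zpow_natCast] at h1
  -- Squaring the growth bound gives `4^n t₀ ≤ C² tₙ`, hence `2^n/tₙ ≤ (C²/t₀) 2^(-n)`.
  have h2 := pow_le_pow_left₀ (by positivity) h1 2
  rw [mul_pow, mul_pow, Real.sq_sqrt (ht 0).le, Real.sq_sqrt (ht n).le] at h2
  have h0 := ht 0
  have hn := ht n
  rw [zpow_natCast, div_le_iff₀ hn, one_div, inv_pow]
  field_simp
  linarith

end GrowthFunction

namespace CompatibleCouple

variable {𝕜 X₀ X₁ 𝒳 : Type*} [RCLike 𝕜]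
  [NormedAddCommGroup X₀] [NormedSpace 𝕜 X₀] [NormedAddCommGroup X₁] [NormedSpace 𝕜 X₁]
  [AddCommGroup 𝒳] [Module 𝕜 𝒳] [TopologicalSpace 𝒳]
  {a : ℝ → ℝ} {C M : ℝ}

/-- The element of `X₀ ∩ X₁` that is the difference of two decompositions of an element. -/
noncomputable def diffInter (X : CompatibleCouple 𝕜 X₀ X₁ 𝒳) {x x' : X₀} {y y' : X₁}
    (h : X.incl₀ x + X.incl₁ y = X.incl₀ x' + X.incl₁ y') : X.interSpace :=
  ⟨(x' - x, y - y'), by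
    have h' : X.ι₀ x + X.ι₁ y = X.ι₀ x' + X.ι₁ y' := congrArg Subtype.val h
    change X.ι₀ (x' - x) = X.ι₁ (y - y')
    rw [map_sub, map_sub, sub_eq_sub_iff_add_eq_add, ← h', add_comm]⟩

/-- Discretization along the points `t k` where `a` takes the value `2 ^ k`. -/
theorem exists_telescoping (X : CompatibleCouple 𝕜 X₀ X₁ 𝒳) (ha : GrowthFunction a C)
    {g : X.SumSpace} (hM : 0 < M) (hK : ∀ t, 0 < t → X.K g t ≤ M * a t)
    {t : ℤ → ℝ} (ht : ∀ k, 0 < t k) (hat : ∀ k, a (t k) = 2 ^ k) :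
    ∃ (x : ℤ → X₀) (y : ℤ → X₁) (w : ℤ → X.interSpace),
      (∀ k, g = X.incl₀ (x k) + X.incl₁ (y k)) ∧ (∀ k, ‖x k‖ ≤ 2 * M * 2 ^ k) ∧
      (∀ k, ‖y k‖ ≤ 2 * M * (2 ^ k / t k)) ∧
      (∀ k, X.interToSum (w k) = X.incl₀ (x (k + 2)) - X.incl₀ (x (k + 1))) ∧
      ∀ k s, s ≤ t (k + 1) → X.J (w k) s ≤ 12 * M * 2 ^ k := by
  have hex : ∀ k, ∃ (f₀ : X₀) (f₁ : X₁), g = X.incl₀ f₀ + X.incl₁ f₁ ∧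
      ‖f₀‖ + t k * ‖f₁‖ < 2 * M * 2 ^ k := fun k => by
    refine X.exists_decomp_of_K_lt ((hK (t k) (ht k)).trans_lt ?_)
    have : (0 : ℝ) < 2 ^ k := by positivity
    rw [hat]
    nlinarith
  choose x y hxy hlt using hex
  have hx : ∀ k, ‖x k‖ ≤ 2 * M * 2 ^ k := fun k => by
    have := mul_nonneg (ht k).le (norm_nonneg (y k))
    linarith [hlt k]
  have hy : ∀ k, t k * ‖y k‖ ≤ 2 * M * 2 ^ k := fun k => by
    linarith [hlt k, norm_nonneg (x k)]
  -- The indices `k+1, k+2` are one ahead of the block `[t k, t (k+1))` that will carry `w k`: then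
  -- `s ≤ t (k+1)` there, so `s` times the `X₁`-norm is controlled by the decompositions at `t
  -- (k+1)` and `t (k+2)`. The constant is `12 = 2·2 + 2·4`.
  refine ⟨x, y, fun k => X.diffInter ((hxy (k + 1)).symm.trans (hxy (k + 2))), hxy, hx,
    fun k => ?_, fun k => X.incl₀.map_sub _ _, fun k s hs => max_le ?_ ?_⟩
  · rw [mul_div_assoc', le_div_iff₀ (ht k), mul_comm]
    exact hy k
  · have h1 := hx (k + 1)
    have h2 := hx (k + 2)
    rw [zpow_add₀ two_ne_zero] at h1 h2
    norm_num at h1 h2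
    calc ‖x (k + 2) - x (k + 1)‖ ≤ ‖x (k + 2)‖ + ‖x (k + 1)‖ := norm_sub_le _ _
      _ ≤ _ := by linarith
  · have h1 := hy (k + 1)
    have h2 := hy (k + 2)
    rw [zpow_add₀ two_ne_zero] at h1 h2
    norm_num at h1 h2
    have h12 : t (k + 1) ≤ t (k + 2) := by
      rw [← ha.strictMonoOn.le_iff_le (ht _) (ht _), hat, hat]
      exact zpow_le_zpow_right₀ one_le_two (by omega)
    have h3 : t (k + 1) * ‖y (k + 2)‖ ≤ t (k + 2) * ‖y (k + 2)‖ := by gcongr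
    calc s * ‖y (k + 1) - y (k + 2)‖ ≤ t (k + 1) * (‖y (k + 1)‖ + ‖y (k + 2)‖) :=
          mul_le_mul hs (norm_sub_le _ _) (norm_nonneg _) (ht _).le
      _ ≤ _ := by linarith

variable [IsTopologicalAddGroup 𝒳] [ContinuousSMul 𝕜 𝒳] [T2Space 𝒳]

/-- At the lower end the `X₀`-parts vanish because `2^k → 0`. At the upper end the `X₀`-part is `g`
minus an `X₁`-part of size `O(2^k/t k)`, which also vanishes. -/
theorem eq_of_hasSum_telescoping (X : CompatibleCouple 𝕜 X₀ X₁ 𝒳) (ha : GrowthFunction a C)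
    {g S : X.SumSpace} {t : ℤ → ℝ} (ht : ∀ k, 0 < t k) (hat : ∀ k, a (t k) = 2 ^ k)
    {x : ℤ → X₀} {y : ℤ → X₁} (hxy : ∀ k, g = X.incl₀ (x k) + X.incl₁ (y k))
    (hx : ∀ k, ‖x k‖ ≤ 2 * M * 2 ^ k) (hy : ∀ k, ‖y k‖ ≤ 2 * M * (2 ^ k / t k))
    (hS : HasSum (fun k : ℤ => X.incl₀ (x (k + 2)) - X.incl₀ (x (k + 1))) S) : g = S := by
  -- Pairing `i` with `-(i+1)` makes the partial sums run over `-n ≤ k < n`.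
  have h1 := hS.nat_add_neg_add_one.tendsto_sum_nat
  have hpart : ∀ n : ℕ, ∑ i ∈ Finset.range n,
      ((X.incl₀ (x ((i : ℤ) + 2)) - X.incl₀ (x ((i : ℤ) + 1))) +
        (X.incl₀ (x (-((i : ℤ) + 1) + 2)) - X.incl₀ (x (-((i : ℤ) + 1) + 1)))) =
      X.incl₀ (x ((n : ℤ) + 1)) - X.incl₀ (x (1 - (n : ℤ))) := by
    intro n
    induction n with
    | zero => simp
    | succ n ih =>
      rw [Finset.sum_range_succ, ih]
      push_cast
      rw [show -((n : ℤ) + 1) + 2 = 1 - n by ring, show -((n : ℤ) + 1) + 1 = 1 - (n + 1) by ring,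
        show (n : ℤ) + 1 + 1 = n + 2 by ring]
      abel
  simp only [hpart] at h1
  refine tendsto_nhds_unique ?_ h1
  have hlow : Tendsto (fun n : ℕ => X.incl₀ (x (1 - (n : ℤ)))) atTop (𝓝 0) := by
    have hlim : Tendsto (fun n : ℕ => 4 * M * (1 / 2 : ℝ) ^ n) atTop (𝓝 0) := by
      simpa using (tendsto_pow_atTop_nhds_zero_of_lt_one (r := (1 / 2 : ℝ)) (by norm_num)
        (by norm_num)).const_mul (4 * M)
    refine squeeze_zero_norm (fun n => (X.norm_incl₀_le _).trans ((hx _).trans_eq ?_)) hlim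
    rw [zpow_sub₀ two_ne_zero, zpow_one, zpow_natCast, one_div, inv_pow]
    ring
  have hhigh : Tendsto (fun n : ℕ => X.incl₁ (y ((n : ℤ) + 1))) atTop (𝓝 0) := by
    have hlim : Tendsto (fun n : ℕ => 2 * M * ((2 : ℝ) ^ ((n : ℤ) + 1) / t ((n : ℤ) + 1)))
        atTop (𝓝 0) := by
      have := ((ha.tendsto_two_pow_div ht hat).comp (tendsto_add_atTop_nat 1)).const_mul (2 * M)
      simpa only [Function.comp_def, Nat.cast_add, Nat.cast_one, mul_zero] using this
    exact squeeze_zero_norm (fun n => (X.norm_incl₁_le _).trans (hy _)) hlim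
  have heq : ∀ n : ℕ, X.incl₀ (x ((n : ℤ) + 1)) - X.incl₀ (x (1 - (n : ℤ))) =
      g - X.incl₁ (y ((n : ℤ) + 1)) - X.incl₀ (x (1 - (n : ℤ))) := fun n => by
    rw [eq_sub_of_add_eq (hxy ((n : ℤ) + 1)).symm]
  simp only [heq]
  simpa using (tendsto_const_nhds.sub hhigh).sub hlow

/-- The fundamental lemma: an element with `K(g,t) ≤ M a(t)` has a representation with
`J(u(s),s) ≤ 12 M s a'(s)`. -/
theorem exists_represents [CompleteSpace X₀] [CompleteSpace X₁] (X : CompatibleCouple 𝕜 X₀ X₁ 𝒳)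
    (ha : GrowthFunction a C) {g : X.SumSpace} (hM : 0 < M)
    (hK : ∀ t, 0 < t → X.K g t ≤ M * a t) :
    ∃ u : ℝ → X.interSpace, X.Represents u g ∧
      ∀ s, 0 < s → X.J (u s) s ≤ 12 * M * (s * deriv a s) := by
  choose t ht hat using fun k : ℤ => ha.exists_eq (show (0 : ℝ) < 2 ^ k by positivity)
  obtain ⟨x, y, w, hxy, hx, hy, hw, hJ⟩ := X.exists_telescoping ha hM hK ht hat
  have hmem : ∀ k s, s ∈ Ico (t k) (t (k + 1)) ↔ 0 < s ∧ Int.log 2 (a s) = k := fun k s =>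
    ha.mem_Ico_iff_log_eq (ht k) (ht (k + 1)) (hat k) (hat (k + 1))
  -- On block `k` this is `s a'(s) 2^(-k) w k`; the factor `s` cancels against `ds/s`.
  set u : ℝ → X.interSpace := fun s =>
    ((s * (deriv a s / 2 ^ Int.log 2 (a s)) : ℝ) : 𝕜) • w (Int.log 2 (a s)) with hu
  have hum : AEStronglyMeasurable u (volume.restrict (Ioi 0)) := by
    have hl := ha.aemeasurable_log
    have h1 : AEMeasurable (fun s => s * (deriv a s / 2 ^ Int.log 2 (a s)))
        (volume.restrict (Ioi 0)) := by
      refine measurable_id.aemeasurable.mul ((measurable_deriv a).aemeasurable.div ?_)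
      exact (Measurable.of_discrete (f := fun k : ℤ => (2 : ℝ) ^ k)).comp_aemeasurable hl
    have h2 : AEStronglyMeasurable
        (fun s => ((s * (deriv a s / 2 ^ Int.log 2 (a s)) : ℝ) : 𝕜)) (volume.restrict (Ioi 0)) :=
      RCLike.continuous_ofReal.comp_aestronglyMeasurable h1.aestronglyMeasurable
    have h3 : AEStronglyMeasurable (fun s => w (Int.log 2 (a s))) (volume.restrict (Ioi 0)) :=
      (StronglyMeasurable.of_discrete (f := w)).aestronglyMeasurable.comp_aemeasurable hl
    exact h2.smul h3
  have huJ : ∀ s, 0 < s → X.J (u s) s ≤ 12 * M * (s * deriv a s) := by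
    intro s hs
    have hd := ha.deriv_nonneg hs
    have h1 := hJ (Int.log 2 (a s)) s ((hmem _ s).2 ⟨hs, rfl⟩).2.le
    have h2 : (0 : ℝ) < 2 ^ Int.log 2 (a s) := by positivity
    rw [hu, J_smul, RCLike.norm_ofReal, abs_of_nonneg (by positivity)]
    calc _ ≤ s * (deriv a s / 2 ^ Int.log 2 (a s)) * (12 * M * 2 ^ Int.log 2 (a s)) := by gcongr
      _ = _ := by field_simp
  have hui := X.integrableOn_interToSum ha hum (by positivity : 0 ≤ 12 * M)
    ((ae_restrict_mem measurableSet_Ioi).mono fun s hs => huJ s hs)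
  refine ⟨u, ⟨hum, hui, ?_⟩, huJ⟩
  have hU : ⋃ k, Ico (t k) (t (k + 1)) = Ioi 0 := by
    ext s
    simp only [mem_iUnion, hmem, exists_and_left, exists_eq', and_true, mem_Ioi]
  have hdisj : Pairwise (Function.onFun Disjoint fun k => Ico (t k) (t (k + 1))) := by
    intro i j hij
    refine Set.disjoint_left.2 fun s hi hj => hij ?_
    rw [← ((hmem i s).1 hi).2, ((hmem j s).1 hj).2]
  have hblock : ∀ k, ∫ s in Ico (t k) (t (k + 1)), s⁻¹ • X.interToSum (u s) =
      X.incl₀ (x (k + 2)) - X.incl₀ (x (k + 1)) := by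
    intro k
    have h1 : ∫ s in Ico (t k) (t (k + 1)), s⁻¹ • X.interToSum (u s) =
        ∫ s in Ico (t k) (t (k + 1)), (deriv a s / 2 ^ k) • X.interToSum (w k) := by
      refine setIntegral_congr_fun measurableSet_Ico fun s hs => ?_
      obtain ⟨hs0, hs1⟩ := (hmem k s).1 hs
      simp only [hu, hs1, map_smul]
      rw [← real_smul_eq, smul_smul, inv_mul_cancel_left₀ hs0.ne']
    have htk : t k ≤ t (k + 1) := by
      rw [← ha.strictMonoOn.le_iff_le (ht _) (ht _), hat, hat]
      exact zpow_le_zpow_right₀ one_le_two (by omega)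
    rw [h1, integral_Ico_eq_integral_Ioc, integral_smul_const, integral_div,
      ha.integral_deriv_Ioc (ht k) htk, hat, hat, ← hw, zpow_add_one₀ two_ne_zero]
    have h2 : (2 : ℝ) ^ k ≠ 0 := by positivity
    -- The density `a'/2^k` has mass one, since `a` climbs from `2^k` to `2^(k+1)` on the block.
    rw [show ((2 : ℝ) ^ k * 2 - 2 ^ k) / 2 ^ k = 1 by field_simp; norm_num, one_smul]
  have hS := hasSum_integral_iUnion (fun k => measurableSet_Ico) hdisj (hU ▸ hui)
  simp only [hblock, hU] at hS
  exact X.eq_of_hasSum_telescoping ha ht hat hxy hx hy hS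

end CompatibleCouple

/-! ### Comparison of the norms. -/

namespace CompatibleCouple

variable {𝕜 X₀ X₁ 𝒳 : Type*} [RCLike 𝕜]
  [NormedAddCommGroup X₀] [NormedSpace 𝕜 X₀] [NormedAddCommGroup X₁] [NormedSpace 𝕜 X₁]
  [AddCommGroup 𝒳] [Module 𝕜 𝒳] [TopologicalSpace 𝒳]

theorem coincide_of_le (X : CompatibleCouple 𝕜 X₀ X₁ 𝒳) {N N' : X.SumSpace → ℝ≥0∞} {C C' : ℝ}
    (hC : 0 < C) (hC' : 0 < C') (h : ∀ f, N f ≤ ENNReal.ofReal C * N' f)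
    (h' : ∀ f, N' f ≤ ENNReal.ofReal C' * N f) : X.Coincide N N' := by
  refine ⟨?_, C'⁻¹, C, by positivity, hC, fun f _ => ⟨?_, h f⟩⟩
  · ext f
    exact ⟨fun hf => (h' f).trans_lt (ENNReal.mul_lt_top ENNReal.ofReal_lt_top hf),
      fun hf => (h f).trans_lt (ENNReal.mul_lt_top ENNReal.ofReal_lt_top hf)⟩
  · rw [ENNReal.ofReal_inv_of_pos hC']
    exact ENNReal.inv_mul_le_iff (by simpa using hC') ENNReal.ofReal_ne_top |>.2 (h' f)

theorem le_mul_addX₀ (X : CompatibleCouple 𝕜 X₀ X₁ 𝒳) {N : X.SumSpace → ℝ≥0∞} {C : ℝ}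
    (hC : 0 < C) {f : X.SumSpace} {y : ℝ≥0∞}
    (h : ∀ (f₀ : X₀) (g : X.SumSpace), f = X.incl₀ f₀ + g → y ≤ ENNReal.ofReal C * (‖f₀‖ₑ + N g)) :
    y ≤ ENNReal.ofReal C * X.addX₀ N f := by
  have hC0 : ENNReal.ofReal C ≠ 0 := by simpa using hC
  rw [← ENNReal.inv_mul_le_iff hC0 ENNReal.ofReal_ne_top]
  refine le_iInf fun f₀ => le_iInf fun g => le_iInf fun hf => ?_
  rw [ENNReal.inv_mul_le_iff hC0 ENNReal.ofReal_ne_top]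
  exact h f₀ g hf

theorem addX₀_le (X : CompatibleCouple 𝕜 X₀ X₁ 𝒳) (N : X.SumSpace → ℝ≥0∞) {f g : X.SumSpace}
    {f₀ : X₀} (h : f = X.incl₀ f₀ + g) : X.addX₀ N f ≤ ‖f₀‖ₑ + N g :=
  iInf_le_of_le f₀ (iInf_le_of_le g (iInf_le_of_le h le_rfl))

/-- Since `C ≥ 1`, the same constant also absorbs the `X₀`-term. -/
theorem addX₀_le_mul (X : CompatibleCouple 𝕜 X₀ X₁ 𝒳) {N N' : X.SumSpace → ℝ≥0∞} {C : ℝ}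
    (hC : 1 ≤ C) (h : ∀ g, N g ≤ ENNReal.ofReal C * N' g) (f : X.SumSpace) :
    X.addX₀ N f ≤ ENNReal.ofReal C * X.addX₀ N' f := by
  refine X.le_mul_addX₀ (by linarith) fun f₀ g hf => (X.addX₀_le N hf).trans ?_
  rw [mul_add]
  refine add_le_add ?_ (h g)
  calc ‖f₀‖ₑ = 1 * ‖f₀‖ₑ := (one_mul _).symm
    _ ≤ _ := by
      gcongr
      simpa using hC

/-- `X₀ + (X₀, X₁)_{0,∞,B;K}` is contained in `(X₀, X₁)_{0,∞,b;K}` when `b` is bounded and dominated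
by `B`. -/
theorem kNorm_le_mul_addX₀_kNorm (X : CompatibleCouple 𝕜 X₀ X₁ 𝒳) {b B : ℝ → ℝ}
    (hb : ContinuousOn b (Ioi 0)) (hb0 : ∀ t, 0 < t → 0 < b t)
    (hB : ContinuousOn B (Ioi 0)) (hB0 : ∀ t, 0 < t → 0 < B t)
    {L D : ℝ} (hL : 0 < L) (hD : 0 < D) (hbL : ∀ t, 0 < t → b t ≤ L)
    (hbB : ∀ t, 0 < t → b t ≤ D * B t) (f : X.SumSpace) :
    X.kNorm 0 ∞ (fun t => ENNReal.ofReal (b t)) f ≤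
      ENNReal.ofReal (L + D) * X.addX₀ (X.kNorm 0 ∞ fun t => ENNReal.ofReal (B t)) f := by
  refine X.le_mul_addX₀ (by positivity) fun f₀ g hf => ?_
  refine ENNReal.le_ofReal_mul_of_forall_real (by positivity) fun M hM hle => ?_
  have h0 : ‖f₀‖ ≤ M := by
    rw [← ENNReal.ofReal_le_ofReal_iff hM.le, ofReal_norm]
    exact le_self_add.trans hle
  have h1 := (X.kNorm_le_ofReal_iff hB hB0 hM.le).1 (le_add_self.trans hle)
  refine (X.kNorm_le_ofReal_iff hb hb0 (by positivity)).2 fun t ht => ?_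
  have hKg := X.K_nonneg g ht.le
  calc b t * X.K f t ≤ b t * (‖f₀‖ + X.K g t) := by
        rw [hf]
        exact mul_le_mul_of_nonneg_left (X.K_incl₀_add_le f₀ g ht.le) (hb0 t ht).le
    _ = b t * ‖f₀‖ + b t * X.K g t := mul_add _ _ _
    _ ≤ L * M + D * B t * X.K g t := by
        refine add_le_add (mul_le_mul (hbL t ht) h0 (norm_nonneg _) hL.le) ?_
        exact mul_le_mul_of_nonneg_right (hbB t ht) hKg
    _ ≤ (L + D) * M := by
        have := mul_le_mul_of_nonneg_left (h1 t ht) hD.le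
        linarith

/-- `(X₀, X₁)_{0,∞,b;K}` is contained in `X₀ + (X₀, X₁)_{0,∞,B;K}` when `B = b` on `[1,∞)` and
`t B(t)` is bounded on `(0,1)`. -/
theorem addX₀_kNorm_le_mul_kNorm (X : CompatibleCouple 𝕜 X₀ X₁ 𝒳) {b B : ℝ → ℝ}
    (hb : ContinuousOn b (Ioi 0)) (hb0 : ∀ t, 0 < t → 0 < b t) (hanti : AntitoneOn b (Ioi 0))
    (hB : ContinuousOn B (Ioi 0)) (hB0 : ∀ t, 0 < t → 0 < B t) (hBb : ∀ t, 1 ≤ t → B t = b t)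
    {E : ℝ} (hE : 0 < E) (hBE : ∀ t, 0 < t → t < 1 → t * B t ≤ E * b 1) (f : X.SumSpace) :
    X.addX₀ (X.kNorm 0 ∞ fun t => ENNReal.ofReal (B t)) f ≤
      ENNReal.ofReal (2 / b 1 + (2 * E + 3)) * X.kNorm 0 ∞ (fun t => ENNReal.ofReal (b t)) f := by
  have hb1 := hb0 1 one_pos
  refine ENNReal.le_ofReal_mul_of_forall_real (by positivity) fun M hM hle => ?_
  have hK := (X.kNorm_le_ofReal_iff hb hb0 hM.le).1 hle
  -- The infimum need not be attained; doubling the bound leaves room for an actual decomposition.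
  have hK1 : X.K f 1 < 2 * M / b 1 := by
    rw [lt_div_iff₀ hb1]
    linarith [hK 1 one_pos]
  obtain ⟨f₀, f₁, hf, hlt⟩ := X.exists_decomp_of_K_lt hK1
  rw [one_mul] at hlt
  have h0 : ‖f₀‖ ≤ 2 * M / b 1 := by linarith [norm_nonneg f₁]
  have h1 : ‖f₁‖ ≤ 2 * M / b 1 := by linarith [norm_nonneg f₀]
  refine (X.addX₀_le _ hf).trans ?_
  rw [add_mul, ENNReal.ofReal_add (by positivity) (by positivity)]
  refine add_le_add ?_ ((X.kNorm_le_ofReal_iff hB hB0 (by positivity)).2 fun t ht => ?_)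
  · rw [← ofReal_norm]
    exact ENNReal.ofReal_le_ofReal (h0.trans_eq (by ring))
  rcases lt_or_ge t 1 with ht1 | ht1
  · have h2 : X.K (X.incl₁ f₁) t ≤ t * ‖f₁‖ := by
      simpa using X.K_le (f := X.incl₁ f₁) (f₀ := 0) (f₁ := f₁) (by simp) ht.le
    calc B t * X.K (X.incl₁ f₁) t ≤ B t * (t * ‖f₁‖) := by
          have := hB0 t ht
          gcongr
      _ = t * B t * ‖f₁‖ := by ring
      _ ≤ E * b 1 * (2 * M / b 1) :=
          mul_le_mul (hBE t ht ht1) h1 (norm_nonneg _) (by positivity)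
      _ = 2 * E * M := by field_simp
      _ ≤ _ := by nlinarith
  -- Here `f₁ = f - f₀`, and the bound on `K(f,t)` applies because `B = b`.
  · have h2 : X.K (X.incl₁ f₁) t ≤ ‖f₀‖ + X.K f t := by
      have := X.K_incl₀_add_le (-f₀) f ht.le
      rwa [norm_neg, show X.incl₀ (-f₀) + f = X.incl₁ f₁ by rw [hf, map_neg]; abel] at this
    have h3 : b t ≤ b 1 := hanti (mem_Ioi.2 one_pos) (mem_Ioi.2 ht) ht1
    have h4 := hb0 t ht
    rw [hBb t ht1]
    calc b t * X.K (X.incl₁ f₁) t ≤ b t * (‖f₀‖ + X.K f t) := by gcongr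
      _ = b t * ‖f₀‖ + b t * X.K f t := mul_add _ _ _
      _ ≤ b 1 * (2 * M / b 1) + M :=
          add_le_add (mul_le_mul h3 h0 (norm_nonneg _) hb1.le) (hK t ht)
      _ = 3 * M := by field_simp; norm_num
      _ ≤ _ := by nlinarith

/-- Almost everywhere `A(s)` is the reciprocal of `s (1/B)'(s)`, with value `∞` where that
derivative vanishes. -/
theorem eLpNorm_J_le_ofReal_iff (X : CompatibleCouple 𝕜 X₀ X₁ 𝒳) {B : ℝ → ℝ} {A : ℝ → ℝ≥0∞}
    {C : ℝ} (hB0 : ∀ t, 0 < t → 0 < B t) (ha : GrowthFunction (fun x => (B x)⁻¹) C)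
    (hA : ∀ᵐ x ∂(volume.restrict (Ioi (0 : ℝ))),
      A x = ENNReal.ofReal (B x ^ 2) / ENNReal.ofReal (x * -deriv B x))
    (u : ℝ → X.interSpace) {M : ℝ} (hM : 0 ≤ M) :
    eLpNorm (fun t : ℝ => ENNReal.ofReal (t ^ (-(0 : ℝ) - (∞ : ℝ≥0∞).toReal⁻¹)) * A t *
        ENNReal.ofReal (X.J (u t) t)) ∞ (volume.restrict (Ioi 0)) ≤ ENNReal.ofReal M ↔
      ∀ᵐ s ∂(volume.restrict (Ioi (0 : ℝ))),
        X.J (u s) s ≤ M * (s * deriv (fun x => (B x)⁻¹) s) := by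
  have key : ∀ᵐ s ∂(volume.restrict (Ioi (0 : ℝ))),
      (A s * ENNReal.ofReal (X.J (u s) s) ≤ ENNReal.ofReal M ↔
        X.J (u s) s ≤ M * (s * deriv (fun x => (B x)⁻¹) s)) := by
    filter_upwards [hA, ae_restrict_mem measurableSet_Ioi] with s hs hs0
    have hs0 : 0 < s := hs0
    have hBs := hB0 s hs0
    have hd := ha.deriv_nonneg hs0
    have heq : s * deriv (fun x => (B x)⁻¹) s = s * -deriv B s / B s ^ 2 := by
      rw [deriv_inv_of_pos hBs, mul_div_assoc]
    have hp : 0 ≤ s * -deriv B s := by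
      have h1 : 0 ≤ s * -deriv B s / B s ^ 2 := heq ▸ mul_nonneg hs0.le hd
      rwa [le_div_iff₀ (by positivity), zero_mul] at h1
    rw [hs, ENNReal.ofReal_div_mul_le_iff (by positivity) hp (X.J_nonneg _ _) hM, heq]
  have hess : eLpNorm (fun t : ℝ => ENNReal.ofReal (t ^ (-(0 : ℝ) - (∞ : ℝ≥0∞).toReal⁻¹)) * A t *
        ENNReal.ofReal (X.J (u t) t)) ∞ (volume.restrict (Ioi 0)) =
      essSup (fun t => A t * ENNReal.ofReal (X.J (u t) t)) (volume.restrict (Ioi 0)) := by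
    simp [eLpNorm_exponent_top, eLpNormEssSup]
  rw [hess]
  constructor
  · intro h
    filter_upwards [key, ENNReal.ae_le_essSup (μ := volume.restrict (Ioi (0 : ℝ)))
      (fun t => A t * ENNReal.ofReal (X.J (u t) t))] with s hs hs'
    exact hs.1 (hs'.trans h)
  · intro h
    refine essSup_le_of_ae_le _ ?_
    filter_upwards [key, h] with s hs hs'
    exact hs.2 hs'

variable [CompleteSpace X₀] [CompleteSpace X₁]
  [IsTopologicalAddGroup 𝒳] [ContinuousSMul 𝕜 𝒳] [T2Space 𝒳]

theorem kNorm_le_mul_jNorm (X : CompatibleCouple 𝕜 X₀ X₁ 𝒳) {B : ℝ → ℝ} {A : ℝ → ℝ≥0∞}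
    {C : ℝ} (hB : ContinuousOn B (Ioi 0)) (hB0 : ∀ t, 0 < t → 0 < B t)
    (ha : GrowthFunction (fun x => (B x)⁻¹) C)
    (hA : ∀ᵐ x ∂(volume.restrict (Ioi (0 : ℝ))),
      A x = ENNReal.ofReal (B x ^ 2) / ENNReal.ofReal (x * -deriv B x)) (g : X.SumSpace) :
    X.kNorm 0 ∞ (fun t => ENNReal.ofReal (B t)) g ≤
      ENNReal.ofReal (2 * (1 + 4 * C)) * X.jNorm 0 ∞ A g := by
  have hC := ha.const_pos
  refine ENNReal.le_ofReal_mul_of_forall_real (by positivity) fun M hM hle => ?_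
  -- Doubling `M` makes the bound strict, so some representation satisfies it.
  have hlt : X.jNorm 0 ∞ A g < ENNReal.ofReal (2 * M) :=
    hle.trans_lt ((ENNReal.ofReal_lt_ofReal_iff (by positivity)).2 (by linarith))
  obtain ⟨u, hu⟩ := iInf_lt_iff.1 hlt
  obtain ⟨hrep, hu⟩ := iInf_lt_iff.1 hu
  have hJ := (X.eLpNorm_J_le_ofReal_iff hB0 ha hA u (by positivity)).1 hu.le
  refine (X.kNorm_le_ofReal_iff hB hB0 (by positivity)).2 fun t ht => ?_
  have hBt := hB0 t ht
  calc B t * X.K g t ≤ B t * ((1 + 4 * C) * (2 * M) * (B t)⁻¹) := by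
        gcongr
        exact X.K_le_of_represents ha hrep (by positivity) hJ ht
    _ = _ := by field_simp

theorem jNorm_le_mul_kNorm (X : CompatibleCouple 𝕜 X₀ X₁ 𝒳) {B : ℝ → ℝ} {A : ℝ → ℝ≥0∞}
    {C : ℝ} (hB : ContinuousOn B (Ioi 0)) (hB0 : ∀ t, 0 < t → 0 < B t)
    (ha : GrowthFunction (fun x => (B x)⁻¹) C)
    (hA : ∀ᵐ x ∂(volume.restrict (Ioi (0 : ℝ))),
      A x = ENNReal.ofReal (B x ^ 2) / ENNReal.ofReal (x * -deriv B x)) (g : X.SumSpace) :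
    X.jNorm 0 ∞ A g ≤
      ENNReal.ofReal 12 * X.kNorm 0 ∞ (fun t => ENNReal.ofReal (B t)) g := by
  refine ENNReal.le_ofReal_mul_of_forall_real (by positivity) fun M hM hle => ?_
  have hK := (X.kNorm_le_ofReal_iff hB hB0 hM.le).1 hle
  obtain ⟨u, hrep, hJ⟩ := X.exists_represents ha (g := g) hM fun t ht => by
    rw [← div_eq_mul_inv, le_div_iff₀ (hB0 t ht), mul_comm]
    exact hK t ht
  refine iInf_le_of_le u (iInf_le_of_le hrep ?_)
  exact (X.eLpNorm_J_le_ofReal_iff hB0 ha hA u (by positivity)).2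
    ((ae_restrict_mem measurableSet_Ioi).mono fun s hs => hJ s hs)

end CompatibleCouple

/-! ### Gluing at `1` and the conclusion. -/

theorem AntitoneOn.le_of_tendsto_zero {b : ℝ → ℝ} (hb : AntitoneOn b (Ioi 0)) {L : ℝ}
    (hL : Tendsto b (𝓝[>] 0) (𝓝 L)) {t : ℝ} (ht : 0 < t) : b t ≤ L := by
  refine ge_of_tendsto hL ?_
  filter_upwards [Ioo_mem_nhdsGT ht] with s hs
  exact hb (mem_Ioi.2 hs.1) (mem_Ioi.2 ht) hs.2.le

/-- Strictly decreasing functions on `(0,1)` and `[1,∞)` glue to a strictly decreasing function if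
the result is continuous. -/
theorem strictAntiOn_Ioi_of_glue {B : ℝ → ℝ} (hB : ContinuousOn B (Ioi 0))
    (h1 : StrictAntiOn B (Ioo 0 1)) (h2 : StrictAntiOn B (Ici 1)) : StrictAntiOn B (Ioi 0) := by
  have h1' : StrictAntiOn B (Ioc 0 1) := by
    intro x hx y hy hxy
    rcases hy.2.lt_or_eq with hy1 | rfl
    · exact h1 ⟨hx.1, hxy.trans hy1⟩ ⟨hy.1, hy1⟩ hxy
    obtain ⟨z, hxz, hz1⟩ := exists_between hxy
    have hz : z ∈ Ioo (0 : ℝ) 1 := ⟨hx.1.trans hxz, hz1⟩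
    refine lt_of_le_of_lt ?_ (h1 ⟨hx.1, hxy⟩ hz hxz)
    -- Left continuity at `1` gives `B 1 ≤ B z`; the intermediate point `z` restores strictness.
    have hlim : Tendsto B (𝓝[<] 1) (𝓝 (B 1)) :=
      (hB.continuousAt (Ioi_mem_nhds one_pos)).mono_left nhdsWithin_le_nhds
    refine le_of_tendsto hlim ?_
    filter_upwards [Ioo_mem_nhdsLT hz1] with w hw
    exact (h1 hz ⟨hz.1.trans hw.1, hw.2⟩ hw.1).le
  have := h1'.union h2 (isGreatest_Ioc zero_lt_one) isLeast_Ici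
  rwa [Ioc_union_Ici_eq_Ioi zero_lt_one] at this

theorem corollary1p17 {𝕜 X₀ X₁ 𝒳 : Type*} [RCLike 𝕜]
    [NormedAddCommGroup X₀] [NormedSpace 𝕜 X₀] [CompleteSpace X₀]
    [NormedAddCommGroup X₁] [NormedSpace 𝕜 X₁] [CompleteSpace X₁]
    [AddCommGroup 𝒳] [Module 𝕜 𝒳] [TopologicalSpace 𝒳]
    [IsTopologicalAddGroup 𝒳] [ContinuousSMul 𝕜 𝒳] [T2Space 𝒳]
    (X : CompatibleCouple 𝕜 X₀ X₁ 𝒳)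
    (b β B : ℝ → ℝ) (A : ℝ → ℝ≥0∞) (c : ℝ)
    (hb : SlowlyVarying b) (hbac : ACIoi b) (hbanti : StrictAntiOn b (Ioi 0))
    (hb0 : ∃ L : ℝ, Tendsto b (𝓝[>] 0) (𝓝 L)) (hbtop : Tendsto b atTop (𝓝 0))
    (hβ : SlowlyVarying β) (hβac : ACIoi β) (hβanti : StrictAntiOn β (Ioi 0))
    (hβ0 : Tendsto β (𝓝[>] 0) atTop) (hβtop : Tendsto β atTop (𝓝 0))
    (hc : 0 < c)
    (hB : SlowlyVarying B) (hBac : ACIoi B)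
    (hB1 : ∀ x, 1 ≤ x → B x = b x) (hB2 : ∀ x, 0 < x → x < 1 → B x = c * β x)
    (hA : ∀ᵐ x ∂(volume.restrict (Ioi (0 : ℝ))),
      A x = ENNReal.ofReal (B x ^ 2) / ENNReal.ofReal (x * -deriv B x)) :
    X.Coincide (X.kNorm 0 ∞ fun t => ENNReal.ofReal (b t))
        (X.addX₀ (X.kNorm 0 ∞ fun t => ENNReal.ofReal (B t))) ∧
      X.Coincide (X.addX₀ (X.kNorm 0 ∞ fun t => ENNReal.ofReal (B t)))
        (X.addX₀ (X.jNorm 0 ∞ A)) := by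
  have hbc := hbac.continuousOn
  have hBc := hBac.continuousOn
  have hBanti : StrictAntiOn B (Ioi 0) := by
    refine strictAntiOn_Ioi_of_glue hBc (fun x hx y hy hxy => ?_) (fun x hx y hy hxy => ?_)
    · rw [hB2 x hx.1 hx.2, hB2 y hy.1 hy.2]
      exact mul_lt_mul_of_pos_left (hβanti hx.1 hy.1 hxy) hc
    · rw [hB1 x hx, hB1 y hy]
      exact hbanti (mem_Ioi.2 (zero_lt_one.trans_le hx)) (mem_Ioi.2 (zero_lt_one.trans_le hy)) hxy
  have hB0 : Tendsto B (𝓝[>] 0) atTop := by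
    refine (hβ0.const_mul_atTop hc).congr' ?_
    filter_upwards [Ioo_mem_nhdsGT zero_lt_one] with x hx using (hB2 x hx.1 hx.2).symm
  have hBtop : Tendsto B atTop (𝓝 0) := by
    refine hbtop.congr' ?_
    filter_upwards [Ici_mem_atTop 1] with x hx using (hB1 x hx).symm
  obtain ⟨C, ha⟩ := hB.exists_growthFunction_inv hBac hBanti hB0 hBtop
  obtain ⟨L, hL⟩ := hb0
  -- With exponent one this bounds `t B(t)` by `E B(1) = E b(1)` on `(0,1)`.
  obtain ⟨E, hE, hBE⟩ := hB.exists_rpow_mul_le one_pos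
  have hC := ha.const_pos
  have hbL : ∀ t, 0 < t → b t ≤ L := fun t ht => hbanti.antitoneOn.le_of_tendsto_zero hL ht
  have hb1 := hb.pos 1 one_pos
  have hL0 : 0 < L := hb1.trans_le (hbL 1 one_pos)
  have hB1' : B 1 = b 1 := hB1 1 le_rfl
  constructor
  · refine X.coincide_of_le (by positivity) (by positivity)
      -- In `D`, the term `L / b 1` serves `t < 1`, where `b ≤ L` and `B ≥ b 1`; the term `1` serves
      -- `t ≥ 1`, where `B = b`.
      (X.kNorm_le_mul_addX₀_kNorm (D := 1 + L / b 1) hbc hb.pos hBc hB.pos hL0 (by positivity) hbL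
        fun t ht => ?_)
      (X.addX₀_kNorm_le_mul_kNorm hbc hb.pos hbanti.antitoneOn hBc hB.pos hB1 hE
        fun t ht ht1 => ?_)
    · have hBt := hB.pos t ht
      rcases lt_or_ge t 1 with ht1 | ht1
      · have h1 : b 1 ≤ B t := hB1' ▸ (hBanti ht (mem_Ioi.2 one_pos) ht1).le
        calc b t ≤ L := hbL t ht
          _ = L / b 1 * b 1 := by field_simp
          _ ≤ L / b 1 * B t := by gcongr
          _ ≤ _ := by linarith
      · rw [hB1 t ht1] at hBt ⊢
        have : 0 < L / b 1 * b t := by positivity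
        linarith
    · simpa [hB1'] using hBE t 1 ht ht1.le
  · refine X.coincide_of_le (by positivity) (by positivity)
      (X.addX₀_le_mul (C := 2 * (1 + 4 * C)) (by linarith)
        (X.kNorm_le_mul_jNorm hBc hB.pos ha hA))
      (X.addX₀_le_mul (C := 12) (by norm_num) (X.jNorm_le_mul_kNorm hBc hB.pos ha hA))
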